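/- Let $\omega=(\alpha,\beta)$ be a point of the Thoma simplex: $\alpha_1\ge\alpha_2\ge\dots\ge 0$, $\beta_1\ge\beta_2\ge\dots\ge0$, $\sum_i\alpha_i+\sum_j\beta_j\le 1$, and put $\gamma=1-\sum_i\alpha_i-\sum_j\beta_j$. Let $n\ge 0$. **The measure.** For a composition $c$ of $n$ with descent set $D(c)\subseteq\{1,\dots,n-1\}$ and an ordered family $x$ of real numbers, $L_c(x)=\sum x_{i_1}\cdots x_{i_n}$, the sum over $i_1\le\dots\le i_n$ with $i_j<i_{j+1}$ whenever $j\in D(c)$. Let $\mathbf{QSym}$ have linear basis $(L_c)$, with coproduct $\Delta L_c=\sum_{i=0}^n L_{c_{[1,i]}}\otimes L_{c_{[i+1,n]}}$ and involution $\nu L_c=L_{\bar c}$, where $D(c_{[i+1,j]})=(D(c)\cap[i+1,j-1])-i$ and $D(\bar c)=\{1,\dots,n-1\}\setminus D(c^*)$, with $c^*$ the reverse composition. For $\sigma\in\mathfrak S_n$ let $F_\sigma$ be the corresponding basis element of $\mathbf{FQSym}$, $G_\sigma=F_{\sigma^{-1}}$, let $\mathbf{FQSym}\to\mathbf{QSym}$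 send $F_\sigma$ to $L_{c(\sigma)}$, where $D(c(\sigma))=\{i:\sigma(i)>\sigma(i+1)\}$, and set $$f(A-B+\gamma E)=[(\mathrm{id}\otimes\nu\otimes\mathrm{id})\circ(\Delta\otimes\mathrm{id})\circ\Delta]f\,(A,\overline B,\gamma E),\qquad \mathbb Q_{n,\omega}[\sigma]=G_\sigma(A-B+\gamma E),$$ where $A=(\alpha_1,\alpha_2,\dots)$, $\overline B=(\beta_1,\beta_2,\dots)$ and $L_c(\gamma E)=\gamma^n/n!$ for $c$ a composition of $n$. Let $\mathbb Q^{\mathrm{rev}}_{n,\omega}[\sigma]$ be defined in the same way, but with the letters of $\overline B$ in the opposite order $(\dots,\beta_2,\beta_1)$. **The shuffle.** (1) Cut the deck $1,2,\dots,n$ into consecutive blocks of sizes $n_1,n_2,\dots$ (the $\alpha$-blocks, in this order from the top), $m_1,m_2,\dots$ (the $\beta$-blocks), and $l$ (the $\gamma$-block, at the bottom), with $$\mathbb P[n_1,\dots,m_1,\dots,l]=\binom{n}{n_1,\dots,m_1,\dots,l}\prod_i\alpha_i^{n_i}\prod_j\beta_j^{m_j}\,\gamma^l .$$ (2) Reverse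 each $\beta$-block, and put the $\gamma$-block in a uniformly random order. (3) Shuffle the blocks together, two blocks of sizes $k_1,k_2$ being shuffled by taking the first card from the top of the first block with probability $k_1/(k_1+k_2)$ and from the top of the second with probability $k_2/(k_1+k_2)$, and going on in the same way with the remaining cards. The result is the permutation $\sigma$ whose word $\sigma(1)\sigma(2)\cdots\sigma(n)$ is the deck read from top to bottom. **Proposition.** For every $\sigma\in\mathfrak S_n$: * if the $\beta$-blocks lie in the deck in the order $\dots,m_2,m_1$ from top to bottom, the shuffle produces $\sigma$ with probability exactly $\mathbb Q_{n,\omega}[\sigma]$; * if they lie in the order $m_1,m_2,\dots$ from top to bottom, the shuffle produces $\sigma$ with probability exactly $\mathbb Q^{\mathrm{rev}}_{n,\omega}[\sigma]$. -/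

import Mathlib

open scoped TensorProduct ENNReal

noncomputable section

/-! ## The Thoma simplex -/

/-- A point `ω = (α, β)` of the Thoma simplex (indices start at `0`). -/
structure ThomaPoint where
  α : ℕ → ℝ
  β : ℕ → ℝ
  α_antitone : Antitone α
  β_antitone : Antitone β
  α_nonneg : ∀ i, 0 ≤ α i
  β_nonneg : ∀ i, 0 ≤ β i
  α_summable : Summable α
  β_summable : Summable β
  sum_le_one : ∑' i, α i + ∑' i, β i ≤ 1

/-- `γ = 1 - ∑ α_i - ∑ β_i`. -/
def ThomaPoint.γ (ω : ThomaPoint) : ℝ := 1 - ∑' i, ω.α i - ∑' i, ω.β i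

/-! ## Compositions and descents -/

/-- `D(c) = {c₁, c₁ + c₂, …, c₁ + ⋯ + c_{r-1}} ⊆ {1, …, n-1}`. -/
def Composition.descents {n : ℕ} (c : Composition n) : Finset ℕ :=
  (Finset.Ico 1 c.length).image c.sizeUpTo

/-- The composition of `n` whose descent set is `D ∩ {1, …, n-1}`. -/
def Composition.ofDescents (n : ℕ) (D : Finset ℕ) : Composition n :=
  ((compositionAsSetEquiv n).symm
    (Finset.univ.filter fun k : Fin (n - 1) => (k : ℕ) + 1 ∈ D)).toComposition

/-- `c_{⟦i+1, j⟧}`: the composition of `j - i` with descent set `(D(c) ∩ {i+1, …, j-1}) - i`. -/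
def Composition.slice {n : ℕ} (c : Composition n) (i j : ℕ) : Composition (j - i) :=
  Composition.ofDescents (j - i)
    ((c.descents ∩ Finset.Icc (i + 1) (j - 1)).image fun d => d - i)

/-- The conjugate composition: `D(c̄) = {1, …, n-1} \ D(c*)`, where `c*` is the reverse of `c`. -/
def Composition.conj {n : ℕ} (c : Composition n) : Composition n :=
  Composition.ofDescents n (Finset.Icc 1 (n - 1) \ c.reverse.descents)

/-- The descents of `σ`, as a subset of `{1, …, n-1}`: `d` is a descent when the `d`-th letter of
the word of `σ` is larger than the `(d+1)`-st one. Letters and positions of permutations are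
numbered from `0`, so that these are the letters at `d - 1` and `d`. -/
def permDescents {n : ℕ} (σ : Equiv.Perm (Fin n)) : Finset ℕ :=
  (Finset.univ.filter fun b : Fin n => ∃ a : Fin n, (a : ℕ) + 1 = b ∧ σ b < σ a).image Fin.val

/-- `c(σ)`, the composition that encodes the descents of `σ`. -/
def permComposition {n : ℕ} (σ : Equiv.Perm (Fin n)) : Composition n :=
  Composition.ofDescents n (permDescents σ)

/-! ## Quasi-symmetric functions and free quasi-symmetric functions -/

/-- `QSym`, through its linear basis `(L_c)`, where `c` runs over all compositions. -/
abbrev QSym : Type := (Σ n : ℕ, Composition n) →₀ ℝ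

/-- The fundamental quasi-symmetric function `L_c`. -/
def QSym.L {n : ℕ} (c : Composition n) : QSym := Finsupp.single ⟨n, c⟩ 1

/-- `FQSym`, through its linear basis `(F_σ)`, where `σ` runs over all permutations. -/
abbrev FQSym : Type := (Σ n : ℕ, Equiv.Perm (Fin n)) →₀ ℝ

/-- The free quasi-symmetric function `F_σ`. -/
def FQSym.F {n : ℕ} (σ : Equiv.Perm (Fin n)) : FQSym := Finsupp.single ⟨n, σ⟩ 1

/-- `G_σ = F_{σ⁻¹}`. -/
def FQSym.G {n : ℕ} (σ : Equiv.Perm (Fin n)) : FQSym := FQSym.F σ⁻¹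

/-- The quotient map `FQSym → QSym`, `F_σ ↦ L_{c(σ)}`. -/
def FQSym.toQSym : FQSym →ₗ[ℝ] QSym :=
  Finsupp.linearCombination ℝ fun s => QSym.L (permComposition s.2)

/-- The coproduct `Δ(L_c) = ∑_{i=0}^n L_{c_{⟦1,i⟧}} ⊗ L_{c_{⟦i+1,n⟧}}`. -/
def QSym.Δ : QSym →ₗ[ℝ] QSym ⊗[ℝ] QSym :=
  Finsupp.linearCombination ℝ fun s =>
    ∑ i ∈ Finset.range (s.1 + 1), QSym.L (s.2.slice 0 i) ⊗ₜ[ℝ] QSym.L (s.2.slice i s.1)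

/-- The involution `ν(L_c) = L_{c̄}`. -/
def QSym.ν : QSym →ₗ[ℝ] QSym :=
  Finsupp.linearCombination ℝ fun s => QSym.L s.2.conj

/-- The value of `L_c` on a family `x` of real numbers indexed by an ordered set: the sum of
`x_{i₁} ⋯ x_{iₙ}` over all `i₁ ≤ ⋯ ≤ iₙ` such that `i_j < i_{j+1}` whenever `j ∈ D(c)`. -/
def Composition.evalL {κ : Type} [LinearOrder κ] {n : ℕ} (c : Composition n) (x : κ → ℝ) : ℝ :=
  ∑' i : {i : Fin n → κ // Monotone i ∧
      ∀ a b : Fin n, (a : ℕ) + 1 = b → (b : ℕ) ∈ c.descents → i a < i b},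
    ∏ a, x (i.1 a)

/-- The specialization of `QSym` that replaces the variables by the ordered family `x`. -/
def QSym.evalAlphabet {κ : Type} [LinearOrder κ] (x : κ → ℝ) : QSym →ₗ[ℝ] ℝ :=
  Finsupp.linearCombination ℝ fun s => s.2.evalL x

/-- The exponential specialization `L_c(γE) = γⁿ / n!`. -/
def QSym.evalExp (γ : ℝ) : QSym →ₗ[ℝ] ℝ :=
  Finsupp.linearCombination ℝ fun s => γ ^ s.1 / (s.1.factorial : ℝ)

/-- The specialization `f(A - B + γE) = [(id ⊗ ν ⊗ id) ∘ (Δ ⊗ id) ∘ Δ] f (A, B̄, γE)` of `QSym`.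
The letters of `B̄`, which are the numbers `β_i`, are listed in the order given by the enumeration
`e` of their indices by the ordered set `κ`: the identity of `ℕ` gives `(β₁, β₂, …)`. -/
def ThomaPoint.evalQSym (ω : ThomaPoint) {κ : Type} [LinearOrder κ] (e : κ ≃ ℕ) :
    QSym →ₗ[ℝ] ℝ :=
  LinearMap.mul' ℝ ℝ ∘ₗ
    TensorProduct.map
      (LinearMap.mul' ℝ ℝ ∘ₗ
        TensorProduct.map (QSym.evalAlphabet ω.α)
          (QSym.evalAlphabet (fun k => ω.β (e k)) ∘ₗ QSym.ν))
      (QSym.evalExp ω.γ) ∘ₗ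
    QSym.Δ.rTensor QSym ∘ₗ QSym.Δ

/-- `G_σ(A - B + γE)`, with the letters of `B̄` in the order given by `e`. -/
def ThomaPoint.evalG (ω : ThomaPoint) {κ : Type} [LinearOrder κ] (e : κ ≃ ℕ) {n : ℕ}
    (σ : Equiv.Perm (Fin n)) : ℝ :=
  ω.evalQSym e (FQSym.toQSym (FQSym.G σ))

/-- `ℚ_{n,ω}[σ] = G_σ(A - B + γE)`, with `B̄ = (β₁, β₂, …)`. -/
def ThomaPoint.Q (ω : ThomaPoint) {n : ℕ} (σ : Equiv.Perm (Fin n)) : ℝ :=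
  ω.evalG (Equiv.refl ℕ) σ

/-! ## The multinomial law -/

/-- The multinomial weights of `n` draws with parameter `p`. -/
def multinomialWeight {ι : Type} (p : ι → ℝ≥0∞) (n : ℕ) (k : ι →₀ ℕ) : ℝ≥0∞ :=
  if (k.sum fun _ m => m) = n then (k.multinomial : ℝ≥0∞) * k.prod fun i m => p i ^ m else 0

theorem sum_multinomialWeight {ι : Type} [DecidableEq ι] (p : ι → ℝ≥0∞) (n : ℕ) (s : Finset ι) :
    ∑ k ∈ s.finsuppAntidiag n, multinomialWeight p n k = (∑ i ∈ s, p i) ^ n := by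
  rw [Finset.sum_pow_eq_sum_piAntidiag]
  refine Finset.sum_bij (fun k _ => (k : ι → ℕ)) ?_ ?_ ?_ ?_
  · intro k hk
    rw [Finset.mem_finsuppAntidiag] at hk
    rw [Finset.mem_piAntidiag]
    exact ⟨hk.1, fun i hi => hk.2 (Finsupp.mem_support_iff.2 hi)⟩
  · intro a _ b _ h
    exact DFunLike.coe_injective h
  · intro f hf
    rw [Finset.mem_piAntidiag] at hf
    refine ⟨Finsupp.onFinset s f hf.2, ?_, rfl⟩
    rw [Finset.mem_finsuppAntidiag]
    exact ⟨hf.1, Finsupp.support_onFinset_subset⟩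
  · intro k hk
    have hk' := Finset.mem_finsuppAntidiag'.1 hk
    rw [multinomialWeight, if_pos hk'.1, Finsupp.multinomial_of_support_subset hk'.2,
      Finsupp.prod_of_support_subset k hk'.2 _ (by simp)]

theorem tsum_multinomialWeight {ι : Type} (p : ι → ℝ≥0∞) (n : ℕ) (hp : ∑' i, p i = 1) :
    ∑' k, multinomialWeight p n k = 1 := by
  classical
  apply le_antisymm
  · rw [ENNReal.tsum_eq_iSup_sum]
    refine iSup_le fun S => ?_
    calc ∑ k ∈ S, multinomialWeight p n k
        ≤ ∑ k ∈ (S.biUnion Finsupp.support).finsuppAntidiag n, multinomialWeight p n k := by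
          refine Finset.sum_le_sum_of_ne_zero fun k hk h0 => ?_
          rw [Finset.mem_finsuppAntidiag']
          refine ⟨?_, Finset.subset_biUnion_of_mem _ hk⟩
          by_contra h
          exact h0 (if_neg h)
      _ = (∑ i ∈ S.biUnion Finsupp.support, p i) ^ n := sum_multinomialWeight ..
      _ ≤ 1 := pow_le_one₀ zero_le (hp ▸ ENNReal.sum_le_tsum _)
  · have h : Filter.Tendsto (fun s : Finset ι => (∑ i ∈ s, p i) ^ n) Filter.atTop
        (nhds ((1 : ℝ≥0∞) ^ n)) :=
      ((ENNReal.continuous_pow n).tendsto _).comp (hp ▸ ENNReal.summable.hasSum)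
    rw [one_pow] at h
    refine le_of_tendsto' h fun s => ?_
    rw [← sum_multinomialWeight]
    exact ENNReal.sum_le_tsum _

/-- The multinomial law of parameter `p`: the sizes `k` have probability
`n! / ∏ k_i! * ∏ p_i ^ k_i` when they add up to `n`. -/
def multinomialLaw {ι : Type} (p : ι → ℝ≥0∞) (hp : ∑' i, p i = 1) (n : ℕ) : PMF (ι →₀ ℕ) :=
  ⟨multinomialWeight p n, tsum_multinomialWeight p n hp ▸ ENNReal.summable.hasSum⟩

/-! ## The generalized riffle shuffle -/

/-- The choice between two piles of sizes `a` and `b`: the first one (`true`) with probability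
`a / (a + b)`, the second one (`false`) with probability `b / (a + b)`. -/
def pileChoice (a b : ℕ) (h : 0 < a + b) : PMF Bool :=
  PMF.ofFintype
    (fun t => bif t then (a : ℝ≥0∞) / ((a + b : ℕ) : ℝ≥0∞) else (b : ℝ≥0∞) / ((a + b : ℕ) : ℝ≥0∞))
    (by
      rw [Fintype.sum_bool, cond_true, cond_false, ENNReal.div_add_div_same, ← Nat.cast_add]
      exact ENNReal.div_self (by exact_mod_cast h.ne') (ENNReal.natCast_ne_top _))

/-- Riffling two piles together: the first card of the new deck is the top card of a pile chosen
with probability proportional to its size, and one goes on with the remaining cards. A pile is the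
list of its cards from top to bottom. -/
def riffle {C : Type} : List C → List C → PMF (List C)
  | [], v => PMF.pure v
  | u, [] => PMF.pure u
  | x :: u, y :: v =>
    (pileChoice (u.length + 1) (v.length + 1) (by omega)).bind fun t =>
      if t then (riffle u (y :: v)).map (x :: ·) else (riffle (x :: u) v).map (y :: ·)
termination_by u v => u.length + v.length

/-- Riffling several independent random piles together. -/
def riffleAll {C : Type} : List (PMF (List C)) → PMF (List C)
  | [] => PMF.pure []
  | P :: Ps => P.bind fun u => (riffleAll Ps).bind fun v => riffle u v

/-- A uniformly random rearrangement of a pile. -/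
def uniformOrder {C : Type} (u : List C) : PMF (List C) :=
  (PMF.uniformOfFintype (Equiv.Perm (Fin u.length))).map fun τ => List.ofFn fun i => u.get (τ i)

/-- The names of the blocks, in the order of the blocks in the deck, from top to bottom: first the
`α`-blocks, then the `β`-blocks in the order of `κ`, then the `γ`-block. -/
abbrev BlockLabel (κ : Type) : Type := ℕ ⊕ₗ (κ ⊕ₗ Unit)

/-- The parameter of the multinomial law of the block sizes. -/
def ThomaPoint.blockWeight (ω : ThomaPoint) {κ : Type} (e : κ ≃ ℕ) (i : BlockLabel κ) : ℝ≥0∞ :=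
  Sum.elim (fun a => ENNReal.ofReal (ω.α a))
    (fun j => Sum.elim (fun k => ENNReal.ofReal (ω.β (e k)))
      (fun _ => ENNReal.ofReal ω.γ) (ofLex j)) (ofLex i)

theorem ThomaPoint.tsum_blockWeight (ω : ThomaPoint) {κ : Type} (e : κ ≃ ℕ) :
    ∑' i, ω.blockWeight e i = 1 := by
  have h1 : HasSum (fun a => ENNReal.ofReal (ω.α a)) (ENNReal.ofReal (∑' i, ω.α i)) := by
    rw [ENNReal.ofReal_tsum_of_nonneg ω.α_nonneg ω.α_summable]
    exact ENNReal.summable.hasSum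
  have h2 : HasSum (fun k => ENNReal.ofReal (ω.β (e k))) (ENNReal.ofReal (∑' i, ω.β i)) := by
    rw [ENNReal.ofReal_tsum_of_nonneg ω.β_nonneg ω.β_summable]
    exact (e.hasSum_iff (f := fun k => ENNReal.ofReal (ω.β k))).2 ENNReal.summable.hasSum
  have h3 : HasSum (fun _ : Unit => ENNReal.ofReal ω.γ) (ENNReal.ofReal ω.γ) :=
    hasSum_unique _
  let f : ℕ ⊕ (κ ⊕ Unit) ≃ BlockLabel κ := (Equiv.sumCongr (Equiv.refl ℕ) toLex).trans toLex
  have h4 : HasSum (fun i => ω.blockWeight e (f i))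
      (ENNReal.ofReal (∑' i, ω.α i) + (ENNReal.ofReal (∑' i, ω.β i) + ENNReal.ofReal ω.γ)) :=
    HasSum.sum h1 (HasSum.sum h2 h3)
  have hγ : 0 ≤ ω.γ := by have := ω.sum_le_one; unfold ThomaPoint.γ; linarith
  rw [← ENNReal.ofReal_add (tsum_nonneg ω.β_nonneg) hγ, ← ENNReal.ofReal_add
    (tsum_nonneg ω.α_nonneg) (add_nonneg (tsum_nonneg ω.β_nonneg) hγ)] at h4
  have h5 : ∑' i, ω.α i + (∑' i, ω.β i + ω.γ) = 1 := by unfold ThomaPoint.γ; ring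
  rw [h5, ENNReal.ofReal_one] at h4
  exact (f.tsum_eq (ω.blockWeight e)).symm.trans h4.tsum_eq

/-- What is done to a block after the cut: an `α`-block is kept, a `β`-block is reversed, and the
`γ`-block is put in a uniformly random order. -/
def treatBlock {κ C : Type} (i : BlockLabel κ) (u : List C) : PMF (List C) :=
  Sum.elim (fun _ => PMF.pure u)
    (fun j => Sum.elim (fun _ => PMF.pure u.reverse) (fun _ => uniformOrder u) (ofLex j)) (ofLex i)

/-- Cutting a deck into consecutive blocks of sizes `k`, from top to bottom in the order of the
labels (empty blocks are omitted). -/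
def cutDeck {ι C : Type} [LinearOrder ι] (k : ι →₀ ℕ) (deck : List C) : List (ι × List C) :=
  (k.support.sort (· ≤ ·)).zip (((k.support.sort (· ≤ ·)).map k).splitLengths deck)

/-- The law of the deck after an `ω`-shuffle of the ordered deck `0, 1, …, n-1`, where the
`β`-blocks lie in the deck in the order of `κ` and the block `k` has parameter `β_{e k}`: cut
multinomially, treat each block, riffle the blocks together. -/
def ThomaPoint.shuffle (ω : ThomaPoint) {κ : Type} [LinearOrder κ] (e : κ ≃ ℕ) (n : ℕ) :
    PMF (List (Fin n)) :=
  (multinomialLaw (ω.blockWeight e) (ω.tsum_blockWeight e) n).bind fun k =>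
    riffleAll ((cutDeck k (List.finRange n)).map fun b => treatBlock b.1 b.2)

/-- The probability that the `ω`-shuffle produces `σ`, that is, that the resulting deck, read from
top to bottom, is the word `σ(1) σ(2) ⋯ σ(n)`. -/
def ThomaPoint.shuffleProb (ω : ThomaPoint) {κ : Type} [LinearOrder κ] (e : κ ≃ ℕ) {n : ℕ}
    (σ : Equiv.Perm (Fin n)) : ℝ :=
  (ω.shuffle e n (List.ofFn σ)).toReal

end

/-! ## The law of a riffle shuffle -/

/-! Both sides are the same finite sum over $i+k+l=n$: a fundamental sum in the $\alpha$'s for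
$D=D(c(\sigma^{-1}))$ on the first $i$ positions, a fundamental sum in the $\beta$'s for the
complement of $D$ on the next $k$, and $\gamma^l/l!$.

Shuffle side. All interleavings of two piles are equally likely, so riffling piles of sizes $k_b$
gives a fixed compatible deck with probability $\prod k_b!/n!$ (`riffleAll_mul_factorial`). This
cancels the multinomial coefficient of the cut (`ThomaPoint.shuffle_apply_ofFn`). Block sizes amount
to weakly increasing labellings of the cards by blocks. An $\alpha$-block appears in its order in
$\sigma$ iff $\sigma^{-1}$ has no descent inside it, a $\beta$-block appears reversed iff every
adjacent pair inside it is a descent, and the $\gamma$-block contributes $1/l!$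
(`treatBlock_apply`). So labels must increase strictly at descents in the $\alpha$ part and at
non-descents in the $\beta$ part. Splitting a labelling where its letters change type factors the
sum (`tsum_eq_sum_antidiagonal_joinLabels`).

Algebraic side. The iterated coproduct cuts the descent set at the same places. The involution $\nu$
complements descents but also reverses positions; by `fundamentalSum_reverse`, that reversal amounts
to listing the alphabet backwards. Hence the order of the $\beta$-blocks in the deck is opposite to
the order of the letters of $\overline B$.

Infinite sums are handled in `ℝ≥0∞`, and real values are taken only at the end. -/

theorem PMF.map_cons_apply_cons {C : Type} (P : PMF (List C)) (x z : C) (w : List C)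
    [Decidable (z = x)] : P.map (x :: ·) (z :: w) = if z = x then P w else 0 := by
  rw [PMF.map_apply]
  split_ifs with h
  · subst h
    rw [tsum_eq_single w]
    · simp
    · intro u hu
      simp [hu.symm]
  · simp [h]

/-- Multiplying by the factorial of the total size clears the denominator of the choice, since
$\frac{c}{N}N!=c\,(N-1)!$. The two factorials on the right are kept in the shapes that the recursion
of `riffle` produces. -/
theorem pileChoice_bind_mul_factorial {D : Type} (a b : ℕ) (h : 0 < a + 1 + (b + 1))
    (P Q : PMF D) (w : D) :
    ((pileChoice (a + 1) (b + 1) h).bind fun t => if t then P else Q) w *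
        ((a + 1 + (b + 1)).factorial : ℝ≥0∞) =
      (a + 1 : ℕ) * (P w * ((a + (b + 1)).factorial : ℝ≥0∞)) +
        (b + 1 : ℕ) * (Q w * ((a + 1 + b).factorial : ℝ≥0∞)) := by
  have h0 : ((a + 1 + (b + 1) : ℕ) : ℝ≥0∞) ≠ 0 := by exact_mod_cast h.ne'
  have ht : ((a + 1 + (b + 1) : ℕ) : ℝ≥0∞) ≠ ∞ := ENNReal.natCast_ne_top _
  have e1 : (a + 1 + (b + 1)).factorial = (a + 1 + (b + 1)) * (a + 1 + b).factorial := by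
    rw [show a + 1 + (b + 1) = (a + 1 + b) + 1 by omega, Nat.factorial_succ]
  have e2 : (a + (b + 1)).factorial = (a + 1 + b).factorial := by congr 1; omega
  rw [PMF.bind_apply, tsum_bool, e1, e2, Nat.cast_mul]
  simp only [pileChoice, PMF.ofFintype_apply, cond_true, cond_false, if_true, Bool.false_eq_true,
    if_false]
  set N : ℝ≥0∞ := ((a + 1 + (b + 1) : ℕ) : ℝ≥0∞)
  set f : ℝ≥0∞ := ((a + 1 + b).factorial : ℝ≥0∞)
  have key : ∀ c x : ℝ≥0∞, c / N * x * (N * f) = c * (x * f) := by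
    intro c x
    calc c / N * x * (N * f) = c / N * N * (x * f) := by ring
      _ = c * (x * f) := by rw [ENNReal.div_mul_cancel h0 ht]
  rw [add_mul, key, key, add_comm]

/-- All interleavings are equally likely. The colour `p` tells the piles apart, so the first card of
`w` determines which pile was chosen and only one branch of the recursion survives; it contributes
$(a+1)\cdot a!\,b!=(a+1)!\,b!$, or symmetrically. -/
theorem riffle_mul_factorial {C : Type} [DecidableEq C] (p : C → Bool) (u v w : List C)
    (hu : ∀ c ∈ u, p c = true) (hv : ∀ c ∈ v, p c = false) :
    riffle u v w * ((u.length + v.length).factorial : ℝ≥0∞) =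
      if w.filter p = u ∧ w.filter (fun c => !p c) = v then
        (u.length.factorial : ℝ≥0∞) * v.length.factorial else 0 := by
  induction u, v using riffle.induct generalizing w with
  | case1 v =>
    rw [riffle, PMF.pure_apply]
    by_cases h : w = v
    · subst h
      have h1 : w.filter p = [] := List.filter_eq_nil_iff.2 fun c hc => by simp [hv c hc]
      have h2 : w.filter (fun c => !p c) = w := List.filter_eq_self.2 fun c hc => by simp [hv c hc]
      simp [h1, h2]
    · rw [if_neg h, if_neg, zero_mul]
      rintro ⟨h1, h2⟩
      apply h
      rw [← h2, eq_comm, List.filter_eq_self]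
      intro c hc
      have := List.filter_eq_nil_iff.1 h1 c hc
      simpa using this
  | case2 u hne =>
    have hr : riffle u [] = PMF.pure u := by
      cases u with
      | nil => exact absurd rfl hne
      | cons => rw [riffle]; simp
    rw [hr, PMF.pure_apply]
    by_cases h : w = u
    · subst h
      have h1 : w.filter p = w := List.filter_eq_self.2 hu
      have h2 : w.filter (fun c => !p c) = [] :=
        List.filter_eq_nil_iff.2 fun c hc => by simp [hu c hc]
      simp [h1, h2]
    · rw [if_neg h, if_neg, zero_mul]
      rintro ⟨h1, h2⟩
      apply h
      rw [← h1, eq_comm, List.filter_eq_self]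
      intro c hc
      have := List.filter_eq_nil_iff.1 h2 c hc
      simpa using this
  | case3 x u y v ih1 ih2 =>
    have hx : p x = true := hu x (by simp)
    have hy : p y = false := hv y (by simp)
    rw [riffle, List.length_cons, List.length_cons, pileChoice_bind_mul_factorial]
    cases w with
    | nil => simp
    | cons z w =>
      rw [PMF.map_cons_apply_cons, PMF.map_cons_apply_cons]
      have i1 := ih1 w (fun c hc => hu c (by simp [hc])) hv
      have i2 := ih2 w hu (fun c hc => hv c (by simp [hc]))
      rw [List.length_cons] at i1 i2
      simp only [ite_mul, zero_mul]
      rw [i1, i2]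
      cases hz : p z with
      | true =>
        have hzy : z ≠ y := by rintro rfl; simp [hy] at hz
        rw [if_neg hzy, mul_zero, add_zero, List.filter_cons_of_pos (by simpa using hz),
          List.filter_cons_of_neg (by simp [hz])]
        by_cases hzx : z = x
        · subst hzx
          simp only [if_true, List.cons.injEq, true_and, mul_ite, mul_zero]
          congr 1
          rw [Nat.factorial_succ u.length]
          push_cast
          ring
        · rw [if_neg hzx, mul_zero, if_neg]
          rintro ⟨h, -⟩
          exact hzx (List.cons.inj h).1
      | false =>
        have hzx : z ≠ x := by rintro rfl; simp [hx] at hz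
        rw [if_neg hzx, mul_zero, zero_add, List.filter_cons_of_neg (by simp [hz]),
          List.filter_cons_of_pos (by simp [hz])]
        by_cases hzy : z = y
        · subst hzy
          simp only [if_true, List.cons.injEq, true_and, mul_ite, mul_zero]
          congr 1
          rw [Nat.factorial_succ v.length]
          push_cast
          ring
        · rw [if_neg hzy, mul_zero, if_neg]
          rintro ⟨-, h⟩
          exact hzy (List.cons.inj h).1

/-- The factorial now depends on `w` alone, so it can be moved in and out of sums over `u` and `v`.
If `w` is not an interleaving, the probability itself vanishes. -/
theorem riffle_mul_length_factorial {C : Type} [DecidableEq C] (p : C → Bool) (u v w : List C)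
    (hu : ∀ c ∈ u, p c = true) (hv : ∀ c ∈ v, p c = false) :
    riffle u v w * (w.length.factorial : ℝ≥0∞) =
      if w.filter p = u ∧ w.filter (fun c => !p c) = v then
        (u.length.factorial : ℝ≥0∞) * v.length.factorial else 0 := by
  have h := riffle_mul_factorial p u v w hu hv
  split_ifs at h ⊢ with hc
  · rw [← h, ← hc.1, ← hc.2, List.length_eq_length_filter_add p]
  · rcases mul_eq_zero.1 h with h | h
    · rw [h, zero_mul]
    · exact absurd h (by exact_mod_cast Nat.factorial_ne_zero _)

/-- The law of the deck obtained by riffling together random piles whose cards carry distinct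
labels. -/
theorem riffleAll_mul_factorial {ι C : Type} [DecidableEq ι] [DecidableEq C] (ℓ : C → ι)
    (bs : List (ι × PMF (List C))) (hbs : (bs.map Prod.fst).Nodup)
    (hP : ∀ b ∈ bs, ∀ u, b.2 u ≠ 0 → ∀ c ∈ u, ℓ c = b.1) (w : List C) :
    riffleAll (bs.map Prod.snd) w * (w.length.factorial : ℝ≥0∞) =
      if ∀ c ∈ w, ℓ c ∈ bs.map Prod.fst then
        (bs.map fun b => ((w.filter fun c => ℓ c = b.1).length.factorial : ℝ≥0∞) *
          b.2 (w.filter fun c => ℓ c = b.1)).prod else 0 := by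
  induction bs generalizing w with
  | nil =>
    cases w with
    | nil => simp [riffleAll]
    | cons c w =>
      rw [if_neg fun h => by simpa using h c (by simp)]
      simp [riffleAll]
  | cons b bs ih =>
    obtain ⟨i, P⟩ := b
    rw [List.map_cons, List.nodup_cons] at hbs
    replace ih := ih hbs.2 fun b hb => hP b (List.mem_cons_of_mem _ hb)
    replace hP := hP (i, P) (by simp)
    simp only at hP hbs
    set R := riffleAll (bs.map Prod.snd) with hR
    have hRs : ∀ v, R v ≠ 0 → ∀ c ∈ v, ℓ c ∈ bs.map Prod.fst := by
      intro v hv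
      by_contra h
      have := ih v
      rw [if_neg h] at this
      rcases mul_eq_zero.1 this with h | h
      · exact hv h
      · exact absurd h (by exact_mod_cast Nat.factorial_ne_zero _)
    -- The labels separate `u` from `v` only on the supports of `P` and `R`; elsewhere a zero factor
    -- makes both sides vanish.
    have hterm : ∀ u v, P u * (R v * (riffle u v w * (w.length.factorial : ℝ≥0∞))) =
        P u * (R v * if w.filter (fun c => decide (ℓ c = i)) = u ∧
          w.filter (fun c => !decide (ℓ c = i)) = v then
        (u.length.factorial : ℝ≥0∞) * v.length.factorial else 0) := by
      intro u v
      by_cases hu : P u = 0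
      · simp [hu]
      by_cases hv : R v = 0
      · simp [hv]
      rw [riffle_mul_length_factorial fun c => decide (ℓ c = i)]
      · intro c hc
        simpa using hP u hu c hc
      · intro c hc
        rw [decide_eq_false_iff_not]
        intro h
        exact hbs.1 (h ▸ hRs v hv c hc)
    rw [List.map_cons, riffleAll, PMF.bind_apply, ← hR]
    simp only [PMF.bind_apply]
    rw [← ENNReal.tsum_mul_right]
    simp only [mul_assoc, ← ENNReal.tsum_mul_right]
    simp only [← ENNReal.tsum_mul_left, hterm]
    -- The deck `w` determines both piles as its subwords, so a single term of the double sum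
    -- remains.
    rw [tsum_eq_single (w.filter fun c => decide (ℓ c = i)),
      tsum_eq_single (w.filter fun c => !decide (ℓ c = i))]
    rotate_left
    · intro v hv
      rw [if_neg fun h => hv h.2.symm, mul_zero, mul_zero]
    · intro u hu
      rw [ENNReal.tsum_eq_zero.2]
      intro v
      rw [if_neg fun h => hu h.1.symm, mul_zero, mul_zero]
    rw [if_pos ⟨rfl, rfl⟩]
    have ihv := ih (w.filter fun c => !decide (ℓ c = i))
    rw [show ∀ a b c d : ℝ≥0∞, a * (b * (c * d)) = (c * a) * (b * d) from fun _ _ _ _ => by ring,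
      ihv]
    have hc : (∀ c ∈ w.filter (fun c => !decide (ℓ c = i)), ℓ c ∈ bs.map Prod.fst) ↔
        ∀ c ∈ w, ℓ c ∈ ((i, P) :: bs).map Prod.fst := by
      simp only [List.mem_filter, List.map_cons, List.mem_cons]
      refine forall_congr' fun c => ?_
      by_cases h : ℓ c = i <;> simp [h]
    simp only [hc]
    rw [mul_ite, mul_zero]
    congr 1
    rw [List.map_cons (l := bs), List.prod_cons]
    congr 1
    apply congrArg List.prod
    apply List.map_congr_left
    intro b hb
    have hbi : b.1 ≠ i := fun h => hbs.1 (h ▸ List.mem_map_of_mem hb)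
    have : (w.filter fun c => !decide (ℓ c = i)).filter (fun c => decide (ℓ c = b.1)) =
        w.filter fun c => decide (ℓ c = b.1) := by
      rw [List.filter_filter]
      apply List.filter_congr
      intro c _
      by_cases h : ℓ c = b.1 <;> simp [h, hbi]
    rw [this]

/-- Cutting a deck whose cards are labelled by their block. -/
theorem zip_splitLengths_eq_map_filter {ι C : Type} [DecidableEq ι] (ℓ : C → ι) (k : ι → ℕ)
    (s : List ι) (hs : s.Nodup) (deck : List C)
    (h : deck.map ℓ = s.flatMap fun i => List.replicate (k i) i) :
    s.zip ((s.map k).splitLengths deck) =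
      s.map fun i => (i, deck.filter fun c => ℓ c = i) := by
  induction s generalizing deck with
  | nil => simp
  | cons i s ih =>
    rw [List.nodup_cons] at hs
    rw [List.flatMap_cons] at h
    have h1 : (deck.take (k i)).map ℓ = List.replicate (k i) i := by
      rw [List.map_take, h, List.take_append_of_le_length (by simp)]
      simp
    have h2 : (deck.drop (k i)).map ℓ = s.flatMap fun i => List.replicate (k i) i := by
      rw [List.map_drop, h, List.drop_append_of_le_length (by simp)]
      simp
    have m1 : ∀ c ∈ deck.take (k i), ℓ c = i := by
      intro c hc
      have := List.mem_map_of_mem (f := ℓ) hc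
      rw [h1] at this
      exact List.eq_of_mem_replicate this
    have m2 : ∀ c ∈ deck.drop (k i), ℓ c ∈ s := by
      intro c hc
      have := List.mem_map_of_mem (f := ℓ) hc
      rw [h2, List.mem_flatMap] at this
      obtain ⟨j, hj, hcj⟩ := this
      rw [List.eq_of_mem_replicate hcj]
      exact hj
    have hf : ∀ j, deck.filter (fun c => ℓ c = j) = (deck.take (k i)).filter (fun c => ℓ c = j) ++
        (deck.drop (k i)).filter (fun c => ℓ c = j) := by
      intro j
      rw [← List.filter_append, List.take_append_drop]
    rw [List.map_cons, List.splitLengths_cons, List.zip_cons_cons, ih hs.2 _ h2, List.map_cons]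
    congr 1
    · rw [hf, List.filter_eq_self.2, List.filter_eq_nil_iff.2, List.append_nil]
      · intro c hc
        have := m2 c hc
        simp only [decide_eq_true_eq]
        rintro rfl
        exact hs.1 this
      · simpa using m1
    · apply List.map_congr_left
      intro j hj
      rw [hf j, (List.filter_eq_nil_iff (l := deck.take (k i))).2, List.nil_append]
      intro c hc
      rw [m1 c hc, decide_eq_true_eq]
      rintro rfl
      exact hs.1 hj

/-! ## Block sizes and block labels -/

/-- The sizes of the fibres of `ℓ`. -/
noncomputable def fiberSizes {ι : Type} {n : ℕ} (ℓ : Fin n → ι) : ι →₀ ℕ :=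
  ∑ a, Finsupp.single (ℓ a) 1

/-- The sorted list in which `i` occurs `k i` times. -/
def sortedLabels {ι : Type} [LinearOrder ι] (k : ι →₀ ℕ) : List ι :=
  (k.support.sort (· ≤ ·)).flatMap fun i => List.replicate (k i) i

theorem coe_sortedLabels {ι : Type} [LinearOrder ι] (k : ι →₀ ℕ) :
    (sortedLabels k : Multiset ι) = Finsupp.toMultiset k := by
  rw [sortedLabels, ← Multiset.coe_bind (k.support.sort (· ≤ ·)) fun i => List.replicate (k i) i,
    Finset.sort_eq, Finsupp.toMultiset_apply, Finsupp.sum, Multiset.bind, Multiset.join,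
    Finset.sum]
  simp only [Multiset.coe_replicate, Multiset.nsmul_singleton]

theorem pairwise_sortedLabels {ι : Type} [LinearOrder ι] (k : ι →₀ ℕ) :
    (sortedLabels k).Pairwise (· ≤ ·) := by
  rw [sortedLabels, List.pairwise_flatMap]
  refine ⟨fun i _ => List.pairwise_replicate.2 (Or.inr le_rfl), ?_⟩
  refine (Finset.pairwise_sort _ _).imp ?_
  intro i j hij x hx y hy
  rw [List.eq_of_mem_replicate hx, List.eq_of_mem_replicate hy]
  exact hij

theorem toMultiset_fiberSizes {ι : Type} {n : ℕ} (ℓ : Fin n → ι) :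
    Finsupp.toMultiset (fiberSizes ℓ) = (List.ofFn ℓ : Multiset ι) := by
  rw [fiberSizes, map_sum]
  simp only [Finsupp.toMultiset_single, one_smul]
  rw [List.ofFn_eq_map, ← Multiset.map_coe]
  refine (congrArg Multiset.sum (Multiset.map_map (fun i => ({i} : Multiset ι)) ℓ _)).symm.trans ?_
  exact Multiset.sum_map_singleton _

/-- Two sorted lists with the same underlying multiset coincide; a weakly increasing labelling is
thus recovered from its fibre sizes. -/
theorem sortedLabels_fiberSizes {ι : Type} [LinearOrder ι] {n : ℕ} (ℓ : Fin n → ι)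
    (hℓ : Monotone ℓ) : sortedLabels (fiberSizes ℓ) = List.ofFn ℓ := by
  have h : (sortedLabels (fiberSizes ℓ) : Multiset ι) = List.ofFn ℓ := by
    rw [coe_sortedLabels, toMultiset_fiberSizes]
  refine (Multiset.coe_eq_coe.1 h).eq_of_pairwise (fun a b _ _ h h' => le_antisymm h h')
    (pairwise_sortedLabels _) ?_
  rw [List.pairwise_ofFn]
  exact fun i j hij => hℓ hij.le

theorem sum_fiberSizes {ι : Type} {n : ℕ} (ℓ : Fin n → ι) :
    ((fiberSizes ℓ).sum fun _ m => m) = n := by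
  refine (Finsupp.card_toMultiset _).symm.trans ?_
  rw [toMultiset_fiberSizes]
  simp

theorem fiberSizes_apply {ι : Type} [DecidableEq ι] {n : ℕ} (ℓ : Fin n → ι) (i : ι) :
    fiberSizes ℓ i = ((List.finRange n).filter fun a => ℓ a = i).length := by
  rw [← Finsupp.count_toMultiset, toMultiset_fiberSizes, Multiset.coe_count, List.ofFn_eq_map,
    List.count, List.countP_map, List.countP_eq_length_filter]
  rfl

theorem mem_support_fiberSizes {ι : Type} {n : ℕ} (ℓ : Fin n → ι) (i : ι) :
    i ∈ (fiberSizes ℓ).support ↔ ∃ a, ℓ a = i := by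
  classical
  rw [← Finsupp.toFinset_toMultiset, toMultiset_fiberSizes]
  simp

theorem prod_fiberSizes {ι : Type} {n : ℕ} (ℓ : Fin n → ι) (p : ι → ℝ≥0∞) :
    ((fiberSizes ℓ).prod fun i m => p i ^ m) = ∏ a, p (ℓ a) := by
  rw [fiberSizes, ← Finsupp.prod_finsetSum_index (by simp) (by intros; exact pow_add _ _ _)]
  simp

/-- Block sizes of total `n` correspond bijectively to weakly increasing labellings of `n` cards,
the inverse being to read off `sortedLabels`. -/
theorem tsum_eq_tsum_fiberSizes {ι : Type} [LinearOrder ι] (n : ℕ) (f : (ι →₀ ℕ) → ℝ≥0∞)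
    (hf : ∀ k, f k ≠ 0 → (k.sum fun _ m => m) = n) :
    ∑' k, f k = ∑' ℓ : {ℓ : Fin n → ι // Monotone ℓ}, f (fiberSizes ℓ.1) := by
  symm
  have hinj : Function.Injective fun ℓ : {ℓ : Fin n → ι // Monotone ℓ} => fiberSizes ℓ.1 := by
    intro ℓ ℓ' h
    apply Subtype.ext
    apply List.ofFn_injective
    rw [← sortedLabels_fiberSizes _ ℓ.2, ← sortedLabels_fiberSizes _ ℓ'.2]
    exact congrArg _ h
  refine hinj.tsum_eq fun k hk => ?_
  have hlen : (sortedLabels k).length = n := by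
    rw [← Multiset.coe_card, coe_sortedLabels]
    exact (Finsupp.card_toMultiset _).trans (hf k hk)
  subst hlen
  refine ⟨⟨(sortedLabels k).get, ?_⟩, ?_⟩
  · intro a b hab
    rcases hab.eq_or_lt with rfl | h
    · exact le_rfl
    · exact List.pairwise_iff_get.1 (pairwise_sortedLabels k) a b h
  · apply Multiset.toFinsupp.symm.injective
    change Finsupp.toMultiset _ = Finsupp.toMultiset _
    rw [toMultiset_fiberSizes, List.ofFn_get, coe_sortedLabels]

/-! ## The treatment of the blocks -/

theorem perm_of_uniformOrder_ne_zero {C : Type} (u v : List C) (h : uniformOrder u v ≠ 0) :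
    v.Perm u := by
  rw [uniformOrder, ← PMF.mem_support_iff, PMF.mem_support_map_iff] at h
  obtain ⟨τ, -, rfl⟩ := h
  have := Equiv.Perm.ofFn_comp_perm τ u.get
  rw [List.ofFn_get] at this
  exact this

/-- As the cards are distinct, exactly one permutation yields `v`: the one sending `i` to the
position in `u` of the `i`-th card of `v`. -/
theorem uniformOrder_apply_of_perm {C : Type} (u v : List C) (hu : u.Nodup) (h : v.Perm u) :
    uniformOrder u v = (u.length.factorial : ℝ≥0∞)⁻¹ := by
  classical
  have hlen := h.length_eq
  have hinj : Function.Injective fun i : Fin u.length =>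
      (⟨u.idxOf (v.get (i.cast hlen.symm)), by
        rw [List.idxOf_lt_length_iff, ← h.mem_iff]; exact List.get_mem _ _⟩ : Fin u.length) := by
    intro i j hij
    have hij' : u.idxOf (v.get (i.cast hlen.symm)) = u.idxOf (v.get (j.cast hlen.symm)) :=
      congrArg Fin.val hij
    rw [List.idxOf_inj (h.mem_iff.1 (List.get_mem _ _))] at hij'
    have := (List.nodup_iff_injective_get.1 (h.nodup_iff.2 hu)) hij'
    exact Fin.ext (by simpa using congrArg Fin.val this)
  let τ : Equiv.Perm (Fin u.length) := Equiv.ofBijective _ (Finite.injective_iff_bijective.1 hinj)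
  have hτ : v = List.ofFn fun i => u.get (τ i) := by
    apply List.ext_get
    · simp [hlen]
    · intro i h1 h2
      simp [τ]
  rw [uniformOrder, PMF.map_apply, tsum_eq_single τ]
  · rw [if_pos hτ, PMF.uniformOfFintype_apply, Fintype.card_perm, Fintype.card_fin]
  · intro τ' hne
    rw [if_neg]
    intro h'
    apply hne
    rw [hτ] at h'
    have := List.ofFn_injective h'
    ext i
    exact congrArg Fin.val (List.nodup_iff_injective_get.1 hu (congrFun this i)).symm

theorem perm_of_treatBlock_ne_zero {κ C : Type} (i : BlockLabel κ) (u v : List C)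
    (h : treatBlock i u v ≠ 0) : v.Perm u := by
  rcases i with a | k | _
  · have : v = u := by
      by_contra hne
      exact h (by change PMF.pure u v = 0; simp [PMF.pure_apply, hne])
    rw [this]
  · have : v = u.reverse := by
      by_contra hne
      exact h (by change PMF.pure u.reverse v = 0; simp [PMF.pure_apply, hne])
    rw [this]
    exact List.reverse_perm u
  · exact perm_of_uniformOrder_ne_zero u v h

/-! ### The law of the shuffle as a sum over labellings of the cards -/

theorem perm_filter_ofFn {n : ℕ} (σ : Equiv.Perm (Fin n)) (p : Fin n → Bool) :
    ((List.ofFn σ).filter p).Perm ((List.finRange n).filter p) := by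
  apply List.Perm.filter
  have := Equiv.Perm.ofFn_comp_perm σ (id : Fin n → Fin n)
  rwa [List.ofFn_id] at this

/-- The factor $\prod k_i!/n!$ of the riffle cancels the multinomial coefficient of the cut. What is
left is one weight per card and one treatment probability per nonempty block. -/
theorem ThomaPoint.shuffle_apply_ofFn (ω : ThomaPoint) {κ : Type} [LinearOrder κ] (e : κ ≃ ℕ)
    {n : ℕ} (σ : Equiv.Perm (Fin n)) :
    ω.shuffle e n (List.ofFn σ) = ∑' ℓ : {ℓ : Fin n → BlockLabel κ // Monotone ℓ},
      (∏ a, ω.blockWeight e (ℓ.1 a)) * ∏ i ∈ (fiberSizes ℓ.1).support,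
        treatBlock i ((List.finRange n).filter fun a => ℓ.1 a = i)
          ((List.ofFn σ).filter fun a => ℓ.1 a = i) := by
  rw [ThomaPoint.shuffle, PMF.bind_apply]
  rw [tsum_eq_tsum_fiberSizes n]
  rotate_left
  · intro k hk
    by_contra h
    apply hk
    change multinomialWeight _ _ _ * _ = 0
    rw [multinomialWeight, if_neg h, zero_mul]
  refine tsum_congr fun ⟨ℓ, hℓ⟩ => ?_
  change multinomialWeight _ _ (fiberSizes ℓ) * _ = _
  simp only
  rw [multinomialWeight, if_pos (sum_fiberSizes ℓ), prod_fiberSizes]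
  set k := fiberSizes ℓ with hk
  have hcut : cutDeck k (List.finRange n) = (k.support.sort (· ≤ ·)).map fun i =>
      (i, (List.finRange n).filter fun a => ℓ a = i) := by
    apply zip_splitLengths_eq_map_filter ℓ k _ (Finset.sort_nodup _ _)
    rw [← List.ofFn_eq_map, ← sortedLabels_fiberSizes ℓ hℓ]
    rfl
  have hbs : ((cutDeck k (List.finRange n)).map fun b => treatBlock b.1 b.2) =
      ((k.support.sort (· ≤ ·)).map fun i => (i, treatBlock i
        ((List.finRange n).filter fun a => ℓ a = i))).map Prod.snd := by
    rw [hcut, List.map_map, List.map_map]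
    rfl
  have hR := riffleAll_mul_factorial ℓ ((k.support.sort (· ≤ ·)).map fun i => (i, treatBlock i
        ((List.finRange n).filter fun a => ℓ a = i)))
        (by rw [List.map_map]; convert Finset.sort_nodup k.support (· ≤ ·); exact List.map_id _)
        (by
          intro b hb u hu c hc
          rw [List.mem_map] at hb
          obtain ⟨i, -, rfl⟩ := hb
          have := (perm_of_treatBlock_ne_zero _ _ _ hu).mem_iff.1 hc
          simpa using (List.mem_filter.1 this).2) (List.ofFn σ)
  have hprod : ∀ (s : Finset (BlockLabel κ)) (g : BlockLabel κ → BlockLabel κ × PMF (List (Fin n)))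
      (F : BlockLabel κ × PMF (List (Fin n)) → ℝ≥0∞),
      (((s.sort (· ≤ ·)).map g).map F).prod = ∏ i ∈ s, F (g i) := by
    intro s g F
    rw [List.map_map, ← Multiset.prod_coe, ← Multiset.map_coe, Finset.sort_eq]
    rfl
  rw [if_pos, List.length_ofFn, hprod] at hR
  rotate_left
  · intro c _
    rw [List.map_map]
    refine List.mem_map.2 ⟨ℓ c, ?_, rfl⟩
    rw [Finset.mem_sort, hk, mem_support_fiberSizes]
    exact ⟨c, rfl⟩
  change _ = ∏ i ∈ k.support, (((List.ofFn σ).filter fun c => ℓ c = i).length.factorial : ℝ≥0∞) *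
    treatBlock i ((List.finRange n).filter fun a => ℓ a = i)
          ((List.ofFn σ).filter fun a => ℓ a = i) at hR
  rw [Finset.prod_mul_distrib] at hR
  have hfac : ∏ i ∈ k.support, (((List.ofFn σ).filter fun c => ℓ c = i).length.factorial : ℝ≥0∞) =
      ((∏ i ∈ k.support, (k i).factorial : ℕ) : ℝ≥0∞) := by
    rw [Nat.cast_prod]
    refine Finset.prod_congr rfl fun i _ => ?_
    rw [(perm_filter_ofFn σ _).length_eq, hk, fiberSizes_apply]
  rw [hfac] at hR
  rw [hbs]
  set T : ℝ≥0∞ := ∏ i ∈ k.support, treatBlock i ((List.finRange n).filter fun a => ℓ a = i)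
          ((List.ofFn σ).filter fun a => ℓ a = i)
  have hm : ((∏ i ∈ k.support, (k i).factorial : ℕ) : ℝ≥0∞) * (k.multinomial : ℝ≥0∞) =
      (n.factorial : ℝ≥0∞) := by
    rw [← Nat.cast_mul, Finsupp.multinomial_eq, Nat.multinomial_spec]
    congr 2
    exact sum_fiberSizes ℓ
  have h0 : (n.factorial : ℝ≥0∞) ≠ 0 := by exact_mod_cast Nat.factorial_ne_zero n
  rw [mul_comm (k.multinomial : ℝ≥0∞), mul_assoc]
  congr 1
  rw [← ENNReal.mul_left_inj h0 (ENNReal.natCast_ne_top _), mul_assoc, hR, ← hm]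
  ring

/-! ### Block treatments in terms of the descents of `σ⁻¹` -/

theorem ite_congr_of_iff {α : Sort*} {p q : Prop} {_ : Decidable p} {_ : Decidable q} {a b : α}
    (h : p ↔ q) : (if p then a else b) = if q then a else b := if_congr h rfl rfl

/-- The fibres of a monotone map are intervals, so a transitive relation propagates from neighbours
to all pairs of a fibre. -/
theorem forall_adjacent_fiber_iff {ι : Type} [PartialOrder ι] {n : ℕ} {ℓ : Fin n → ι}
    (hℓ : Monotone ℓ) (R : Fin n → Fin n → Prop) [IsTrans (Fin n) R] (i : ι) :
    (∀ x y : Fin n, (x : ℕ) + 1 = y → ℓ x = i → ℓ y = i → R x y) ↔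
      ∀ x y, x < y → ℓ x = i → ℓ y = i → R x y := by
  constructor
  · intro h x ⟨y, hy⟩ hxy hx hyi
    induction y with
    | zero => exact absurd (Fin.lt_def.1 hxy) (Nat.not_lt_zero _)
    | succ y ih =>
      have hy' : y < n := by omega
      have hxy' : (x : ℕ) < y + 1 := hxy
      rcases (Nat.lt_succ_iff.1 hxy').eq_or_lt with h' | h'
      · exact h x _ (by simp [h']) hx hyi
      · have hyi' : ℓ ⟨y, hy'⟩ = i := by
          apply le_antisymm
          · rw [← hyi]; exact hℓ (Fin.mk_le_mk.2 (Nat.le_succ _))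
          · rw [← hx]; exact hℓ (Fin.mk_le_mk.2 h'.le)
        exact _root_.trans (ih hy' (Fin.lt_def.2 h') hyi') (h ⟨y, hy'⟩ _ rfl hyi' hyi)
  · intro h x y hxy
    exact h x y (Fin.lt_def.2 (by omega))

theorem pairwise_ofFn_symm_lt {n : ℕ} (σ : Equiv.Perm (Fin n)) :
    (List.ofFn σ).Pairwise fun x y => σ.symm x < σ.symm y := by
  rw [List.pairwise_ofFn]
  intro i j hij
  simpa using hij

/-- The cards with a given property lie in the deck `σ` in the order `r` when `σ⁻¹` is increasing
with respect to `r` on them. -/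
theorem filter_ofFn_eq_iff {n : ℕ} (σ : Equiv.Perm (Fin n)) (p : Fin n → Bool) (u : List (Fin n))
    (hu : u.Perm ((List.finRange n).filter p)) (r : Fin n → Fin n → Prop)
    (hr : u.Pairwise r) (hasymm : ∀ x y, r x y → ¬ r y x) :
    (List.ofFn σ).filter p = u ↔
      ∀ x y, r x y → p x = true → p y = true → σ.symm x < σ.symm y := by
  have hmem : ∀ x, x ∈ u ↔ p x = true := by
    intro x
    rw [hu.mem_iff, List.mem_filter]
    simp
  constructor
  · intro h x y hxy hx hy
    have h1 : u.Pairwise fun x y => σ.symm x < σ.symm y :=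
      h ▸ (pairwise_ofFn_symm_lt σ).filter p
    -- `List.Pairwise` only concerns pairs in list order. The relation is symmetrized to reach
    -- arbitrary pairs; asymmetry of `r` makes the added half vacuous.
    have h2 : u.Pairwise fun x y => (r x y → σ.symm x < σ.symm y) ∧
        (r y x → σ.symm y < σ.symm x) :=
      (hr.and h1).imp fun {a b} hab => ⟨fun _ => hab.2, fun hba => absurd hba (hasymm _ _ hab.1)⟩
    have : Std.Symm fun x y => (r x y → σ.symm x < σ.symm y) ∧
        (r y x → σ.symm y < σ.symm x) := ⟨fun _ _ h => ⟨h.2, h.1⟩⟩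
    have h3 := List.Pairwise.forall_of_forall
      (R := fun x y => (r x y → σ.symm x < σ.symm y) ∧ (r y x → σ.symm y < σ.symm x))
      (fun x _ => ⟨fun hx => absurd hx (hasymm _ _ hx), fun hx => absurd hx (hasymm _ _ hx)⟩) h2
    exact (h3 ((hmem x).2 hx) ((hmem y).2 hy)).1 hxy
  · intro h
    refine ((perm_filter_ofFn σ p).trans hu.symm).eq_of_pairwise
      (le := fun x y => σ.symm x < σ.symm y) ?_ ((pairwise_ofFn_symm_lt σ).filter p) ?_
    · intro a b _ _ h1 h2
      exact absurd h1 h2.asymm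
    · exact hr.imp_of_mem fun {x y} hx hy hxy => h x y hxy ((hmem x).1 hx) ((hmem y).1 hy)

/-- Whether two cards `d - 1` and `d` may both lie in the block `i`, when `D` is the set of the
descents of the inverse of the resulting deck. -/
def allowedInBlock {κ : Type} (D : ℕ → Prop) (d : ℕ) (i : BlockLabel κ) : Prop :=
  Sum.elim (fun _ => ¬ D d) (fun j => Sum.elim (fun _ => D d) (fun _ => True) (ofLex j)) (ofLex i)

/-- The label of the `γ`-block. -/
abbrev gammaLabel (κ : Type) : BlockLabel κ := toLex (Sum.inr (toLex (Sum.inr ())))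

theorem BlockLabel.eq_alpha_or_eq_beta_or_eq_gamma {κ : Type} (i : BlockLabel κ) :
    (∃ a, i = toLex (Sum.inl a)) ∨ (∃ k, i = toLex (Sum.inr (toLex (Sum.inl k)))) ∨
      i = gammaLabel κ := by
  rcases i with a | k | u
  · exact Or.inl ⟨a, rfl⟩
  · exact Or.inr (Or.inl ⟨k, rfl⟩)
  · exact Or.inr (Or.inr rfl)

theorem alpha_ne_gammaLabel {κ : Type} (a : ℕ) :
    (toLex (Sum.inl a) : BlockLabel κ) ≠ gammaLabel κ := Sum.inl_ne_inr

theorem beta_ne_gammaLabel {κ : Type} (k : κ) :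
    (toLex (Sum.inr (toLex (Sum.inl k))) : BlockLabel κ) ≠ gammaLabel κ := fun h =>
  Sum.inl_ne_inr (Sum.inr_injective h)

theorem mem_permDescents_of_adjacent {n : ℕ} (τ : Equiv.Perm (Fin n)) {x y : Fin n}
    (h : (x : ℕ) + 1 = y) : (y : ℕ) ∈ permDescents τ ↔ τ y < τ x := by
  simp only [permDescents, Finset.mem_image, Finset.mem_filter, Finset.mem_univ, true_and]
  constructor
  · rintro ⟨b, ⟨a, hab, hlt⟩, hb⟩
    obtain rfl : b = y := Fin.ext hb
    obtain rfl : a = x := Fin.ext (by omega)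
    exact hlt
  · intro hlt
    exact ⟨y, ⟨x, h, hlt⟩, rfl⟩

open Classical in
-- `σ⁻¹` gives the positions of the cards in the final deck: a block is kept or reversed according
-- as `σ⁻¹` increases or decreases along it, which is read on neighbours. The `γ`-block imposes no
-- condition.
theorem treatBlock_apply {κ : Type} [LinearOrder κ] {n : ℕ} (σ : Equiv.Perm (Fin n))
    {ℓ : Fin n → BlockLabel κ} (hℓ : Monotone ℓ) (i : BlockLabel κ) :
    treatBlock i ((List.finRange n).filter fun a => ℓ a = i)
        ((List.ofFn σ).filter fun a => ℓ a = i) =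
      if ∀ x y : Fin n, (x : ℕ) + 1 = y → ℓ x = i → ℓ y = i →
          allowedInBlock (· ∈ permDescents σ⁻¹) y i then
        if i = gammaLabel κ then ((fiberSizes ℓ (gammaLabel κ)).factorial : ℝ≥0∞)⁻¹ else 1
      else 0 := by
  have hpw : ((List.finRange n).filter fun a => ℓ a = i).Pairwise (· < ·) :=
    (List.pairwise_lt_finRange n).filter _
  rcases i.eq_alpha_or_eq_beta_or_eq_gamma with ⟨a, rfl⟩ | ⟨k, rfl⟩ | rfl
  · change PMF.pure _ _ = _
    rw [PMF.pure_apply, if_neg (alpha_ne_gammaLabel a)]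
    refine ite_congr_of_iff ?_
    rw [filter_ofFn_eq_iff σ _ _ (List.Perm.refl _) (· < ·) hpw (fun _ _ h => h.asymm)]
    have : IsTrans (Fin n) fun x y => σ.symm x < σ.symm y := ⟨fun _ _ _ h h' => h.trans h'⟩
    simp only [decide_eq_true_eq]
    rw [← forall_adjacent_fiber_iff hℓ fun x y => σ.symm x < σ.symm y]
    refine forall_congr' fun x => forall_congr' fun y => forall_congr' fun hxy =>
      forall_congr' fun _ => forall_congr' fun _ => ?_
    change _ ↔ ¬ ((y : ℕ) ∈ permDescents σ⁻¹)
    rw [mem_permDescents_of_adjacent _ hxy, not_lt]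
    have hne : σ.symm x ≠ σ.symm y := by
      intro h
      rw [σ.symm.injective h] at hxy
      omega
    exact ⟨fun h => h.le, fun h => lt_of_le_of_ne h hne⟩
  · change PMF.pure _ _ = _
    rw [PMF.pure_apply, if_neg (beta_ne_gammaLabel k)]
    refine ite_congr_of_iff ?_
    rw [filter_ofFn_eq_iff σ _ _ (List.reverse_perm _) (· > ·) (List.pairwise_reverse.2 hpw)
      (fun _ _ h => lt_asymm h)]
    have : IsTrans (Fin n) fun x y => σ.symm y < σ.symm x := ⟨fun _ _ _ h h' => h'.trans h⟩
    simp only [decide_eq_true_eq]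
    have := forall_adjacent_fiber_iff hℓ (fun x y => σ.symm y < σ.symm x) (toLex (Sum.inr (toLex (Sum.inl k))))
    trans ∀ x y, x < y → ℓ x = toLex (Sum.inr (toLex (Sum.inl k))) → ℓ y = toLex (Sum.inr (toLex (Sum.inl k))) →
      σ.symm y < σ.symm x
    · exact ⟨fun h x y hxy hx hy => h y x hxy hy hx, fun h x y hxy hx hy => h y x hxy hy hx⟩
    rw [← this]
    refine forall_congr' fun x => forall_congr' fun y => forall_congr' fun hxy =>
      forall_congr' fun _ => forall_congr' fun _ => ?_
    exact (mem_permDescents_of_adjacent _ hxy).symm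
  · rw [if_pos (show ∀ x y : Fin n, (x : ℕ) + 1 = y → ℓ x = gammaLabel κ → ℓ y = gammaLabel κ →
      allowedInBlock (· ∈ permDescents σ⁻¹) y (gammaLabel κ) from fun _ _ _ _ _ => trivial),
      if_pos rfl, fiberSizes_apply]
    exact uniformOrder_apply_of_perm _ _ ((List.nodup_finRange n).filter _) (perm_filter_ofFn σ _)

open Classical in
theorem prod_treatBlock {κ : Type} [LinearOrder κ] {n : ℕ} (σ : Equiv.Perm (Fin n))
    {ℓ : Fin n → BlockLabel κ} (hℓ : Monotone ℓ) :
    ∏ i ∈ (fiberSizes ℓ).support, treatBlock i ((List.finRange n).filter fun a => ℓ a = i)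
        ((List.ofFn σ).filter fun a => ℓ a = i) =
      if ∀ x y : Fin n, (x : ℕ) + 1 = y → ℓ x = ℓ y →
          allowedInBlock (· ∈ permDescents σ⁻¹) y (ℓ x) then
        ((fiberSizes ℓ (gammaLabel κ)).factorial : ℝ≥0∞)⁻¹
      else 0 := by
  simp only [treatBlock_apply σ hℓ]
  split_ifs with h
  · rw [Finset.prod_congr rfl fun i _ => if_pos ?_]
    · rw [Finset.prod_ite_eq']
      split_ifs with h'
      · rfl
      -- An empty `γ`-block is missing from the product, which agrees with $1/0!=1$.
      · rw [Finsupp.notMem_support_iff.1 h']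
        simp
    · rintro x y hxy rfl hy
      exact h x y hxy hy.symm
  · push Not at h
    obtain ⟨x, y, hxy, he, hx⟩ := h
    refine Finset.prod_eq_zero ((mem_support_fiberSizes ℓ (ℓ x)).2 ⟨x, rfl⟩) ?_
    rw [if_neg]
    exact fun h => hx (h x y hxy rfl he.symm)

theorem monotone_iff_forall_adjacent {ι : Type} [Preorder ι] {n : ℕ} {f : Fin n → ι} :
    Monotone f ↔ ∀ x y : Fin n, (x : ℕ) + 1 = y → f x ≤ f y := by
  constructor
  · intro h x y hxy
    exact h (Fin.le_def.2 (by omega))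
  · intro h
    cases n with
    | zero => exact fun x => x.elim0
    | succ n =>
      rw [Fin.monotone_iff_le_succ]
      intro i
      exact h _ _ (by simp)

open Classical in
-- Monotonicity is absorbed into the condition on neighbours, and the size of the `γ`-block is
-- written as a sum over positions: both then split when a labelling is cut in two.
theorem ThomaPoint.shuffle_apply_ofFn_eq_tsum_labels (ω : ThomaPoint) {κ : Type} [LinearOrder κ]
    (e : κ ≃ ℕ) {n : ℕ} (σ : Equiv.Perm (Fin n)) :
    ω.shuffle e n (List.ofFn σ) = ∑' ℓ : Fin n → BlockLabel κ,
      if ∀ x y : Fin n, (x : ℕ) + 1 = y →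
          ℓ x ≤ ℓ y ∧ (ℓ x = ℓ y → allowedInBlock (· ∈ permDescents σ⁻¹) y (ℓ x)) then
        (∏ a, ω.blockWeight e (ℓ a)) *
          ((∑ a, if ℓ a = gammaLabel κ then 1 else 0 : ℕ).factorial : ℝ≥0∞)⁻¹
      else 0 := by
  rw [ω.shuffle_apply_ofFn e σ]
  refine (tsum_subtype {ℓ : Fin n → BlockLabel κ | Monotone ℓ} fun ℓ =>
    (∏ a, ω.blockWeight e (ℓ a)) * ∏ i ∈ (fiberSizes ℓ).support,
        treatBlock i ((List.finRange n).filter fun a => ℓ a = i)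
          ((List.ofFn σ).filter fun a => ℓ a = i)).trans ?_
  refine tsum_congr fun ℓ => ?_
  rw [Set.indicator_apply]
  by_cases hℓ : Monotone ℓ
  · have hs : fiberSizes ℓ (gammaLabel κ) = ∑ a, if ℓ a = gammaLabel κ then 1 else 0 := by
      rw [fiberSizes, Finsupp.finsetSum_apply]
      simp only [Finsupp.single_apply]
    rw [if_pos (show ℓ ∈ {ℓ : Fin n → BlockLabel κ | Monotone ℓ} from hℓ), prod_treatBlock σ hℓ, mul_ite, mul_zero, hs]
    refine ite_congr_of_iff ?_
    exact ⟨fun h x y hxy => ⟨monotone_iff_forall_adjacent.1 hℓ x y hxy, h x y hxy⟩,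
      fun h x y hxy => (h x y hxy).2⟩
  · rw [if_neg (show ℓ ∉ {ℓ : Fin n → BlockLabel κ | Monotone ℓ} from hℓ), if_neg]
    exact fun h => hℓ (monotone_iff_forall_adjacent.2 fun x y hxy => (h x y hxy).1)

/-! ## Splitting labellings by a lexicographic sum -/

/-- The labelling by `a` on the first positions and by `b` on the remaining ones. -/
def joinLabels {A B : Type} {n i m : ℕ} (h : i + m = n) (a : Fin i → A) (b : Fin m → B) :
    Fin n → A ⊕ₗ B := fun x =>
  Fin.append (fun y => toLex (Sum.inl (a y))) (fun y => toLex (Sum.inr (b y))) (x.cast h.symm)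

theorem joinLabels_castAdd {A B : Type} {n i m : ℕ} (h : i + m = n) (a : Fin i → A)
    (b : Fin m → B) (y : Fin i) :
    joinLabels h a b ((Fin.castAdd m y).cast h) = toLex (Sum.inl (a y)) := by
  subst h
  exact Fin.append_left _ _ _

theorem joinLabels_natAdd {A B : Type} {n i m : ℕ} (h : i + m = n) (a : Fin i → A)
    (b : Fin m → B) (y : Fin m) :
    joinLabels h a b ((Fin.natAdd i y).cast h) = toLex (Sum.inr (b y)) := by
  subst h
  exact Fin.append_right _ _ _

theorem prod_joinLabels {A B M : Type} [CommMonoid M] {n i m : ℕ} (h : i + m = n)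
    (a : Fin i → A) (b : Fin m → B) (g : A ⊕ₗ B → M) :
    ∏ x, g (joinLabels h a b x) =
      (∏ y, g (toLex (Sum.inl (a y)))) * ∏ y, g (toLex (Sum.inr (b y))) := by
  subst h
  rw [Fin.prod_univ_add]
  congr 1
  · exact Finset.prod_congr rfl fun y _ => congrArg g (joinLabels_castAdd rfl a b y)
  · exact Finset.prod_congr rfl fun y _ => congrArg g (joinLabels_natAdd rfl a b y)

theorem sum_joinLabels {A B M : Type} [AddCommMonoid M] {n i m : ℕ} (h : i + m = n)
    (a : Fin i → A) (b : Fin m → B) (g : A ⊕ₗ B → M) :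
    ∑ x, g (joinLabels h a b x) =
      (∑ y, g (toLex (Sum.inl (a y)))) + ∑ y, g (toLex (Sum.inr (b y))) :=
  prod_joinLabels (M := Multiplicative M) h a b g

/-- The only pair straddling the junction is free by `hS`. The index `d` of `S` refers to the whole
word, hence the shift by `i` in the second part. -/
theorem forall_adjacent_joinLabels {A B : Type} {n i m : ℕ} (h : i + m = n) (a : Fin i → A)
    (b : Fin m → B) (S : ℕ → A ⊕ₗ B → A ⊕ₗ B → Prop)
    (hS : ∀ d a b, S d (toLex (Sum.inl a)) (toLex (Sum.inr b))) :
    (∀ x y : Fin n, (x : ℕ) + 1 = y → S y (joinLabels h a b x) (joinLabels h a b y)) ↔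
      (∀ x y : Fin i, (x : ℕ) + 1 = y → S y (toLex (Sum.inl (a x))) (toLex (Sum.inl (a y)))) ∧
      ∀ x y : Fin m, (x : ℕ) + 1 = y →
        S (i + y) (toLex (Sum.inr (b x))) (toLex (Sum.inr (b y))) := by
  subst h
  constructor
  · intro H
    refine ⟨fun x y hxy => ?_, fun x y hxy => ?_⟩
    · have := H (Fin.castAdd m x) (Fin.castAdd m y) hxy
      rwa [← joinLabels_castAdd rfl a b x, ← joinLabels_castAdd rfl a b y]
    · have := H (Fin.natAdd i x) (Fin.natAdd i y) (by simp; omega)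
      rwa [← joinLabels_natAdd rfl a b x, ← joinLabels_natAdd rfl a b y]
  · rintro ⟨H1, H2⟩ x y hxy
    have el := joinLabels_castAdd (B := B) rfl a b
    have er := joinLabels_natAdd (A := A) rfl a b
    simp only [Fin.cast_eq_self] at el er
    induction x using Fin.addCases with
    | left x =>
      induction y using Fin.addCases with
      | left y => rw [el, el]; exact H1 x y hxy
      | right y => rw [el, er]; exact hS _ _ _
    | right x =>
      induction y using Fin.addCases with
      | left y => simp at hxy; omega
      | right y => rw [er, er]; exact H2 x y (by simp at hxy; omega)

theorem exists_eq_joinLabels {A B : Type} [LinearOrder A] [LinearOrder B] {n : ℕ}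
    {ℓ : Fin n → A ⊕ₗ B} (hℓ : Monotone ℓ) :
    ∃ (i m : ℕ) (h : i + m = n) (a : Fin i → A) (b : Fin m → B), joinLabels h a b = ℓ := by
  classical
  -- The cut is at the first right-hand label; the value `n` stands for the absence of such a label.
  have hex : ∃ x, x = n ∨ ∃ hx : x < n, ∃ b, ℓ ⟨x, hx⟩ = toLex (Sum.inr b) := ⟨n, Or.inl rfl⟩
  obtain ⟨i, hspec, hmin⟩ : ∃ i, (i = n ∨ ∃ hx : i < n, ∃ b, ℓ ⟨i, hx⟩ = toLex (Sum.inr b)) ∧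
      ∀ x < i, ¬ (x = n ∨ ∃ hx : x < n, ∃ b, ℓ ⟨x, hx⟩ = toLex (Sum.inr b)) :=
    ⟨Nat.find hex, Nat.find_spec hex, fun x => Nat.find_min hex⟩
  have hin : i ≤ n := by
    rcases hspec with h | ⟨h, -⟩ <;> omega
  obtain ⟨m, rfl⟩ := Nat.exists_eq_add_of_le hin
  have hl : ∀ y : Fin i, ∃ a, ℓ (Fin.castAdd m y) = toLex (Sum.inl a) := by
    intro y
    rcases h3 : ℓ (Fin.castAdd m y) with a | b
    · exact ⟨a, rfl⟩
    · exact absurd (Or.inr ⟨y.2.trans_le (Nat.le_add_right _ _), b, h3⟩) (hmin y y.2)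
  have hr : ∀ y : Fin m, ∃ b, ℓ (Fin.natAdd i y) = toLex (Sum.inr b) := by
    intro y
    rcases hspec with h | ⟨h, b, hb⟩
    · have := y.2
      omega
    · have h1 : ℓ ⟨i, h⟩ ≤ ℓ (Fin.natAdd i y) := hℓ (Fin.le_def.2 (by simp))
      rw [hb] at h1
      rcases h3 : ℓ (Fin.natAdd i y) with a' | b'
      · rw [h3] at h1
        exact absurd h1 Sum.Lex.not_inr_le_inl
      · exact ⟨b', rfl⟩
  choose a ha using hl
  choose b hb using hr
  refine ⟨i, m, rfl, a, b, ?_⟩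
  funext x
  induction x using Fin.addCases with
  | left x => exact (joinLabels_castAdd rfl a b x).trans (ha x).symm
  | right x => exact (joinLabels_natAdd rfl a b x).trans (hb x).symm

theorem le_of_joinLabels_eq {A B : Type} {n i m i' m' : ℕ} {h : i + m = n} {h' : i' + m' = n}
    {a : Fin i → A} {b : Fin m → B} {a' : Fin i' → A} {b' : Fin m' → B}
    (heq : joinLabels h a b = joinLabels h' a' b') : i' ≤ i := by
  by_contra hlt
  push Not at hlt
  have h1 := congrFun heq ⟨i, by omega⟩
  have h2 := joinLabels_natAdd h a b ⟨0, by omega⟩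
  have h3 := joinLabels_castAdd h' a' b' ⟨i, hlt⟩
  have e2 : (Fin.natAdd i (⟨0, by omega⟩ : Fin m)).cast h = ⟨i, by omega⟩ := Fin.ext (by simp)
  have e3 : (Fin.castAdd m' (⟨i, hlt⟩ : Fin i')).cast h' = ⟨i, by omega⟩ := Fin.ext (by simp)
  rw [e2] at h2
  rw [e3] at h3
  rw [h2, h3] at h1
  exact Sum.inr_ne_inl h1

/-- In the lexicographic sum, a monotone labelling has all its left labels first, so it splits
uniquely at one point. A summand that factors there has a sum that factors for each cut. -/
theorem tsum_eq_sum_antidiagonal_joinLabels {A B : Type} [LinearOrder A] [LinearOrder B] (n : ℕ)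
    (F : (Fin n → A ⊕ₗ B) → ℝ≥0∞) (hF : ∀ ℓ, F ℓ ≠ 0 → Monotone ℓ)
    (FA : (i : ℕ) → (Fin i → A) → ℝ≥0∞) (FB : ℕ → (m : ℕ) → (Fin m → B) → ℝ≥0∞)
    (hFAB : ∀ (i m : ℕ) (h : i + m = n) (a : Fin i → A) (b : Fin m → B),
      F (joinLabels h a b) = FA i a * FB i m b) :
    ∑' ℓ, F ℓ = ∑ p ∈ Finset.HasAntidiagonal.antidiagonal n, (∑' a, FA p.1 a) * ∑' b, FB p.1 p.2 b := by
  let g : (Σ p : Finset.HasAntidiagonal.antidiagonal n, (Fin p.1.1 → A) × (Fin p.1.2 → B)) → Fin n → A ⊕ₗ B :=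
    fun s => joinLabels (Finset.HasAntidiagonal.mem_antidiagonal.1 s.1.2) s.2.1 s.2.2
  have hg : Function.Injective g := by
    rintro ⟨⟨⟨i, m⟩, hp⟩, a, b⟩ ⟨⟨⟨i', m'⟩, hp'⟩, a', b'⟩ heq
    have h : i + m = n := Finset.HasAntidiagonal.mem_antidiagonal.1 hp
    have h' : i' + m' = n := Finset.HasAntidiagonal.mem_antidiagonal.1 hp'
    change joinLabels h a b = joinLabels h' a' b' at heq
    obtain rfl : i = i' := le_antisymm (le_of_joinLabels_eq heq.symm) (le_of_joinLabels_eq heq)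
    obtain rfl : m = m' := by omega
    have ha : a = a' := by
      funext y
      have := congrFun heq ((Fin.castAdd m y).cast h)
      rw [joinLabels_castAdd, joinLabels_castAdd] at this
      exact Sum.inl_injective this
    have hb : b = b' := by
      funext y
      have := congrFun heq ((Fin.natAdd i y).cast h)
      rw [joinLabels_natAdd, joinLabels_natAdd] at this
      exact Sum.inr_injective this
    rw [ha, hb]
  rw [← hg.tsum_eq (f := F), ENNReal.tsum_sigma', tsum_fintype,
    ← Finset.sum_coe_sort (Finset.HasAntidiagonal.antidiagonal n)]
  · refine Finset.sum_congr rfl fun p _ => ?_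
    rw [ENNReal.tsum_prod']
    simp only [g, hFAB, ENNReal.tsum_mul_left, ENNReal.tsum_mul_right]
  · intro ℓ hℓ
    obtain ⟨i, m, h, a, b, rfl⟩ := exists_eq_joinLabels (hF ℓ hℓ)
    exact ⟨⟨⟨(i, m), Finset.HasAntidiagonal.mem_antidiagonal.2 h⟩, a, b⟩, rfl⟩

/-! ### The contributions of the `α`-, `β`- and `γ`-blocks -/

open Classical in
/-- The sum of `x_{f 0} ⋯ x_{f (m-1)}` over the nondecreasing `f` that increase strictly at the
positions in `D`. -/
noncomputable def fundamentalSum {κ : Type} [LinearOrder κ] (m : ℕ) (D : ℕ → Prop)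
    (x : κ → ℝ≥0∞) : ℝ≥0∞ :=
  ∑' f : Fin m → κ, if ∀ a b : Fin m, (a : ℕ) + 1 = b → f a ≤ f b ∧ (D b → f a < f b) then
    ∏ a, x (f a) else 0

theorem fundamentalSum_congr {κ : Type} [LinearOrder κ] {m : ℕ} {D D' : ℕ → Prop}
    (x : κ → ℝ≥0∞) (h : ∀ d, 1 ≤ d → d < m → (D d ↔ D' d)) :
    fundamentalSum m D x = fundamentalSum m D' x := by
  unfold fundamentalSum
  refine tsum_congr fun f => ite_congr_of_iff ?_
  refine forall_congr' fun a => forall_congr' fun b => forall_congr' fun hab => ?_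
  rw [h b (by omega) b.2]

theorem le_and_imp_not_iff {ι : Type} [PartialOrder ι] {s t : ι} {P : Prop} :
    s ≤ t ∧ (s = t → ¬ P) ↔ s ≤ t ∧ (P → s < t) := by
  refine and_congr_right fun h => ?_
  rw [lt_iff_le_and_ne, and_iff_right h, imp_not_comm]

theorem le_and_imp_iff {ι : Type} [PartialOrder ι] {s t : ι} {P : Prop} :
    s ≤ t ∧ (s = t → P) ↔ s ≤ t ∧ (¬ P → s < t) := by
  rw [← le_and_imp_not_iff, not_not]

open Classical in
-- Equal `β`-labels require a descent, so strict increase is forced at non-descents. There is only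
-- one labelling by the `γ`-label, of value $\gamma^l/l!$. The shift `i` is the number of cards in
-- the `α`-blocks.
theorem ThomaPoint.tsum_betaGammaLabels (ω : ThomaPoint) {κ : Type} [LinearOrder κ]
    (e : κ ≃ ℕ) (D : ℕ → Prop) (i m : ℕ) :
    (∑' b : Fin m → κ ⊕ₗ Unit, if ∀ x y : Fin m, (x : ℕ) + 1 = y → b x ≤ b y ∧
        (b x = b y → allowedInBlock D (i + y) (toLex (Sum.inr (b x)))) then
      (∏ x, ω.blockWeight e (toLex (Sum.inr (b x)))) *
        ((∑ x, if b x = toLex (Sum.inr ()) then 1 else 0 : ℕ).factorial : ℝ≥0∞)⁻¹ else 0) =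
      ∑ q ∈ Finset.HasAntidiagonal.antidiagonal m,
        fundamentalSum q.1 (fun d => ¬ D (i + d)) (fun k => ENNReal.ofReal (ω.β (e k))) *
        (ENNReal.ofReal ω.γ ^ q.2 * (q.2.factorial : ℝ≥0∞)⁻¹) := by
  rw [tsum_eq_sum_antidiagonal_joinLabels m _ ?_
      (fun j b => if ∀ x y : Fin j, (x : ℕ) + 1 = y → b x ≤ b y ∧ (¬ D (i + y) → b x < b y) then
        ∏ x, ENNReal.ofReal (ω.β (e (b x))) else 0)
      (fun j l _ => ENNReal.ofReal ω.γ ^ l * (l.factorial : ℝ≥0∞)⁻¹) ?_]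
  · refine Finset.sum_congr rfl fun q _ => ?_
    rw [tsum_fintype (L := .unconditional _) (f := fun _ : Fin q.2 → Unit => _),
      Fintype.sum_unique]
    congr 1
    exact tsum_congr fun f => ite_congr_of_iff Iff.rfl
  · intro ℓ hℓ
    rw [monotone_iff_forall_adjacent]
    by_contra h
    exact hℓ (if_neg fun H => h fun x y hxy => (H x y hxy).1)
  · intro j l h b c
    rw [prod_joinLabels h b c fun t => ω.blockWeight e (toLex (Sum.inr t)),
      sum_joinLabels h b c fun t => if t = toLex (Sum.inr ()) then 1 else 0]
    have hc := forall_adjacent_joinLabels h b c (fun d s t => s ≤ t ∧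
      (s = t → allowedInBlock D (i + d) (toLex (Sum.inr s))))
      fun d s t => ⟨Sum.Lex.inl_le_inr s t, fun h => absurd h Sum.inl_ne_inr⟩
    have h2 : (∏ y, ω.blockWeight e (toLex (Sum.inr (toLex (Sum.inr (c y)))))) =
        ENNReal.ofReal ω.γ ^ l := by
      have hy : ∀ y, ω.blockWeight e (toLex (Sum.inr (toLex (Sum.inr (c y))))) =
          ENNReal.ofReal ω.γ := fun _ => rfl
      rw [Finset.prod_congr rfl fun y _ => hy y]
      simp
    have h3 : (∑ y, if (toLex (Sum.inl (b y)) : κ ⊕ₗ Unit) = toLex (Sum.inr ()) then 1 else 0) +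
        (∑ y, if (toLex (Sum.inr (c y)) : κ ⊕ₗ Unit) = toLex (Sum.inr ()) then 1 else 0) = l := by
      simp
    rw [h2, h3, ite_mul, zero_mul, mul_assoc]
    refine ite_congr_of_iff (hc.trans ?_)
    rw [and_iff_left]
    · refine forall_congr' fun x => forall_congr' fun y => forall_congr' fun hxy => ?_
      rw [Sum.Lex.inl_le_inl_iff, ← le_and_imp_iff]
      exact and_congr_right fun _ => imp_congr Sum.inl_injective.eq_iff Iff.rfl
    · exact fun x y hxy => ⟨Sum.Lex.inr_le_inr_iff.2 le_rfl, fun _ => trivial⟩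

open Classical in
theorem ThomaPoint.tsum_labels (ω : ThomaPoint) {κ : Type} [LinearOrder κ]
    (e : κ ≃ ℕ) (D : ℕ → Prop) (n : ℕ) :
    (∑' ℓ : Fin n → BlockLabel κ, if ∀ x y : Fin n, (x : ℕ) + 1 = y →
          ℓ x ≤ ℓ y ∧ (ℓ x = ℓ y → allowedInBlock D y (ℓ x)) then
        (∏ a, ω.blockWeight e (ℓ a)) *
          ((∑ a, if ℓ a = gammaLabel κ then 1 else 0 : ℕ).factorial : ℝ≥0∞)⁻¹
      else 0) =
      ∑ p ∈ Finset.HasAntidiagonal.antidiagonal n,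
        fundamentalSum p.1 D (fun a => ENNReal.ofReal (ω.α a)) *
        ∑ q ∈ Finset.HasAntidiagonal.antidiagonal p.2,
          fundamentalSum q.1 (fun d => ¬ D (p.1 + d)) (fun k => ENNReal.ofReal (ω.β (e k))) *
          (ENNReal.ofReal ω.γ ^ q.2 * (q.2.factorial : ℝ≥0∞)⁻¹) := by
  rw [tsum_eq_sum_antidiagonal_joinLabels n _ ?_
    (fun i a => if ∀ x y : Fin i, (x : ℕ) + 1 = y → a x ≤ a y ∧ (D y → a x < a y) then
      ∏ x, ENNReal.ofReal (ω.α (a x)) else 0)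
    (fun i m b => if ∀ x y : Fin m, (x : ℕ) + 1 = y → b x ≤ b y ∧
        (b x = b y → allowedInBlock D (i + y) (toLex (Sum.inr (b x)))) then
      (∏ x, ω.blockWeight e (toLex (Sum.inr (b x)))) *
        ((∑ x, if b x = toLex (Sum.inr ()) then 1 else 0 : ℕ).factorial : ℝ≥0∞)⁻¹ else 0) ?_]
  · refine Finset.sum_congr rfl fun p _ => ?_
    rw [ω.tsum_betaGammaLabels e D p.1 p.2]
    rfl
  · intro ℓ hℓ
    rw [monotone_iff_forall_adjacent]
    by_contra h
    exact hℓ (if_neg fun H => h fun x y hxy => (H x y hxy).1)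
  · intro i m h a b
    rw [prod_joinLabels h a b (ω.blockWeight e),
      sum_joinLabels h a b fun t => if t = gammaLabel κ then 1 else 0]
    have hc := forall_adjacent_joinLabels h a b (fun d s t => s ≤ t ∧
      (s = t → allowedInBlock D d s))
      fun d s t => ⟨Sum.Lex.inl_le_inr s t, fun h => absurd h Sum.inl_ne_inr⟩
    have h3 : (∑ y, if (toLex (Sum.inl (a y)) : BlockLabel κ) = gammaLabel κ then 1 else 0) = 0 :=
      Finset.sum_eq_zero fun y _ => if_neg (alpha_ne_gammaLabel _)
    have h4 : ∀ y, ((toLex (Sum.inr (b y)) : BlockLabel κ) = gammaLabel κ) ↔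
        b y = toLex (Sum.inr ()) := fun y => Sum.inr_injective.eq_iff
    have hi : (∀ x y : Fin i, (x : ℕ) + 1 = y →
        (toLex (Sum.inl (a x)) : BlockLabel κ) ≤ toLex (Sum.inl (a y)) ∧
        ((toLex (Sum.inl (a x)) : BlockLabel κ) = toLex (Sum.inl (a y)) →
          allowedInBlock (κ := κ) D y (toLex (Sum.inl (a x))))) ↔
        ∀ x y : Fin i, (x : ℕ) + 1 = y → a x ≤ a y ∧ (D y → a x < a y) := by
      refine forall_congr' fun x => forall_congr' fun y => forall_congr' fun hxy => ?_
      rw [Sum.Lex.inl_le_inl_iff, ← le_and_imp_not_iff]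
      exact and_congr_right fun _ => imp_congr Sum.inl_injective.eq_iff Iff.rfl
    have hj : (∀ x y : Fin m, (x : ℕ) + 1 = y →
        (toLex (Sum.inr (b x)) : BlockLabel κ) ≤ toLex (Sum.inr (b y)) ∧
        ((toLex (Sum.inr (b x)) : BlockLabel κ) = toLex (Sum.inr (b y)) →
          allowedInBlock (κ := κ) D (i + y) (toLex (Sum.inr (b x))))) ↔
        ∀ x y : Fin m, (x : ℕ) + 1 = y → b x ≤ b y ∧ (b x = b y →
          allowedInBlock (κ := κ) D (i + y) (toLex (Sum.inr (b x)))) := by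
      refine forall_congr' fun x => forall_congr' fun y => forall_congr' fun hxy => ?_
      rw [Sum.Lex.inr_le_inr_iff]
      exact and_congr_right fun _ => imp_congr Sum.inr_injective.eq_iff Iff.rfl
    rw [hi, hj] at hc
    have h5 : (∑ y, if (toLex (Sum.inr (b y)) : BlockLabel κ) = gammaLabel κ then 1 else 0) =
        ∑ y, if b y = toLex (Sum.inr ()) then 1 else 0 :=
      Finset.sum_congr rfl fun y _ => ite_congr_of_iff (h4 y)
    rw [h3, zero_add, h5, ite_mul, zero_mul, mul_ite, mul_zero, ← ite_and, ← mul_assoc]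
    exact ite_congr_of_iff hc

theorem ThomaPoint.shuffle_apply_ofFn_eq_sum (ω : ThomaPoint) {κ : Type} [LinearOrder κ]
    (e : κ ≃ ℕ) {n : ℕ} (σ : Equiv.Perm (Fin n)) :
    ω.shuffle e n (List.ofFn σ) = ∑ p ∈ Finset.HasAntidiagonal.antidiagonal n,
      fundamentalSum p.1 (· ∈ permDescents σ⁻¹) (fun a => ENNReal.ofReal (ω.α a)) *
      ∑ q ∈ Finset.HasAntidiagonal.antidiagonal p.2,
        fundamentalSum q.1 (fun d => p.1 + d ∉ permDescents σ⁻¹)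
          (fun k => ENNReal.ofReal (ω.β (e k))) *
        (ENNReal.ofReal ω.γ ^ q.2 * (q.2.factorial : ℝ≥0∞)⁻¹) := by
  rw [← ω.tsum_labels e (· ∈ permDescents σ⁻¹) n, ω.shuffle_apply_ofFn_eq_tsum_labels e σ]

/-! ## Descents of compositions -/

theorem Composition.mem_descents_iff {n : ℕ} (c : Composition n) (d : ℕ) :
    d ∈ c.descents ↔ 0 < d ∧ d < n ∧ ∃ x ∈ c.boundaries, (x : ℕ) = d := by
  simp only [Composition.descents, Finset.mem_image, Finset.mem_Ico, Composition.boundaries,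
    Finset.mem_map, Finset.mem_univ, true_and]
  constructor
  · rintro ⟨i, ⟨h1, h2⟩, rfl⟩
    refine ⟨?_, ?_, _, ⟨⟨i, by omega⟩, rfl⟩, rfl⟩
    · calc 0 = c.sizeUpTo 0 := c.sizeUpTo_zero.symm
        _ < c.sizeUpTo (0 + 1) := c.sizeUpTo_strict_mono (by omega)
        _ ≤ c.sizeUpTo i := c.monotone_sizeUpTo h1
    · exact (c.sizeUpTo_strict_mono h2).trans_le (c.sizeUpTo_le _)
  · rintro ⟨h0, hn, x, ⟨i, rfl⟩, hi⟩
    have hi' : c.sizeUpTo i = d := hi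
    refine ⟨i, ⟨?_, ?_⟩, hi'⟩
    · by_contra h
      have : (i : ℕ) = 0 := by omega
      rw [this, c.sizeUpTo_zero] at hi'
      omega
    · by_contra h
      rw [c.sizeUpTo_ofLength_le _ (by omega)] at hi'
      omega

theorem Composition.mem_descents_ofDescents (n : ℕ) (D : Finset ℕ) (d : ℕ) :
    d ∈ (Composition.ofDescents n D).descents ↔ 0 < d ∧ d < n ∧ d ∈ D := by
  rw [Composition.mem_descents_iff, Composition.ofDescents,
    CompositionAsSet.toComposition_boundaries]
  refine and_congr_right fun h0 => and_congr_right fun hn => ?_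
  simp only [compositionAsSetEquiv, Equiv.coe_fn_symm_mk, Set.mem_toFinset]
  constructor
  · rintro ⟨x, hx, rfl⟩
    -- A boundary is `0`, `n`, or `j + 1` with `j` in the encoding set; only the last kind is
    -- interior.
    rcases hx with rfl | rfl | ⟨j, hj, hx⟩
    · simp at h0
    · simp at hn
    · rw [hx]
      exact (Finset.mem_filter.1 hj).2
  · intro hd
    refine ⟨⟨d, by omega⟩, Or.inr (Or.inr ⟨⟨d - 1, by omega⟩, ?_, ?_⟩), rfl⟩
    · rw [Finset.mem_filter]
      refine ⟨Finset.mem_univ _, ?_⟩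
      rwa [Nat.sub_add_cancel h0]
    · exact (Nat.sub_add_cancel h0).symm

/-- The first `i` parts of the reverse are the last `i` parts of `c`, so partial sums become
complements to `n`. -/
theorem Composition.sub_mem_descents_of_mem_descents_reverse {n : ℕ} (c : Composition n) {d : ℕ}
    (h : d ∈ c.reverse.descents) : n - d ∈ c.descents := by
  rw [Composition.descents, Finset.mem_image] at h ⊢
  obtain ⟨i, hi, rfl⟩ := h
  have hlen : c.reverse.length = c.length := by simp [Composition.length]
  rw [hlen, Finset.mem_Ico] at hi
  refine ⟨c.length - i, Finset.mem_Ico.2 (by omega), ?_⟩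
  have h1 : c.reverse.sizeUpTo i = (c.blocks.drop (c.length - i)).sum := by
    rw [Composition.sizeUpTo, Composition.reverse_blocks, List.take_reverse, List.sum_reverse]
  have h2 := List.sum_take_add_sum_drop c.blocks (c.length - i)
  rw [c.blocks_sum] at h2
  rw [h1, Composition.sizeUpTo]
  omega

theorem Composition.mem_descents_reverse {n : ℕ} (c : Composition n) {d : ℕ} (hn : d < n) : d ∈ c.reverse.descents ↔ n - d ∈ c.descents := by
  refine ⟨c.sub_mem_descents_of_mem_descents_reverse, fun h => ?_⟩
  rw [← c.reverse_reverse] at h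
  have := c.reverse.sub_mem_descents_of_mem_descents_reverse h
  rwa [Nat.sub_sub_self hn.le] at this

theorem Composition.mem_descents_conj {n : ℕ} (c : Composition n) {d : ℕ} (h0 : 0 < d)
    (hn : d < n) : d ∈ c.conj.descents ↔ n - d ∉ c.descents := by
  rw [Composition.conj, Composition.mem_descents_ofDescents, Finset.mem_sdiff, Finset.mem_Icc,
    c.mem_descents_reverse hn]
  constructor
  · exact fun h => h.2.2.2
  · exact fun h => ⟨h0, hn, ⟨h0, by omega⟩, h⟩

theorem Composition.mem_descents_slice {n : ℕ} (c : Composition n) {i j d : ℕ} (h0 : 0 < d)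
    (hd : d < j - i) : d ∈ (c.slice i j).descents ↔ i + d ∈ c.descents := by
  rw [Composition.slice, Composition.mem_descents_ofDescents, Finset.mem_image]
  constructor
  · rintro ⟨-, -, x, hx, rfl⟩
    rw [Finset.mem_inter, Finset.mem_Icc] at hx
    rw [Nat.add_sub_cancel' (by omega)]
    exact hx.1
  · intro h
    exact ⟨h0, hd, i + d, Finset.mem_inter.2 ⟨h, Finset.mem_Icc.2 (by omega)⟩, by omega⟩

/-! ## Evaluation of quasi-symmetric functions -/

/-- Reversing positions and alphabet together preserves weak increase and moves the constraint at
`d` to `m - d`. This is what exchanges the two orders of the `β`'s. -/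
theorem fundamentalSum_reverse {κ κ' : Type} [LinearOrder κ] [LinearOrder κ'] (φ : κ' ≃ κ)
    (hφ : ∀ a b, φ a ≤ φ b ↔ b ≤ a) (m : ℕ) (D : ℕ → Prop) (x : κ → ℝ≥0∞) :
    fundamentalSum m D (fun k => x (φ k)) = fundamentalSum m (fun d => D (m - d)) x := by
  unfold fundamentalSum
  rw [← (Equiv.arrowCongr (Fin.revPerm (n := m)) φ).tsum_eq]
  refine tsum_congr fun f => ?_
  have hlt : ∀ a b, φ a < φ b ↔ b < a := fun a b => by
    rw [← not_le, ← not_le, hφ]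
  have happ : ∀ a, Equiv.arrowCongr (Fin.revPerm (n := m)) φ f a = φ (f a.rev) := fun a => rfl
  simp only [happ]
  have hprod : ∏ a : Fin m, x (φ (f a.rev)) = ∏ a, x (φ (f a)) :=
    Equiv.prod_comp (Fin.revPerm (n := m)) fun a => x (φ (f a))
  rw [hprod]
  refine ite_congr_of_iff ?_
  simp only [happ, hφ, hlt]
  constructor
  · intro h a b hab
    refine h b.rev a.rev ?_ |>.imp id fun h' hD => h' ?_
    · rw [Fin.val_rev, Fin.val_rev]; omega
    · rw [Fin.val_rev, show m - (a + 1 : ℕ) = m - b by omega]; exact hD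
  · intro h a b hab
    have := h b.rev a.rev (by rw [Fin.val_rev, Fin.val_rev]; omega)
    rw [Fin.rev_rev, Fin.rev_rev] at this
    refine this.imp id fun h' hD => h' ?_
    rw [Fin.val_rev, show m - (m - (a + 1 : ℕ)) = b by omega]; exact hD

theorem Composition.evalL_eq_toReal {κ : Type} [LinearOrder κ] {n : ℕ} (c : Composition n)
    (x : κ → ℝ) (hx : ∀ k, 0 ≤ x k) :
    c.evalL x = (fundamentalSum n (· ∈ c.descents) fun k => ENNReal.ofReal (x k)).toReal := by
  classical
  have h1 : fundamentalSum n (· ∈ c.descents) (fun k => ENNReal.ofReal (x k)) =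
      ∑' i : {i : Fin n → κ // Monotone i ∧
      ∀ a b : Fin n, (a : ℕ) + 1 = b → (b : ℕ) ∈ c.descents → i a < i b},
      ∏ a, ENNReal.ofReal (x (i.1 a)) := by
    refine Eq.trans ?_ (tsum_subtype {i : Fin n → κ | Monotone i ∧
      ∀ a b : Fin n, (a : ℕ) + 1 = b → (b : ℕ) ∈ c.descents → i a < i b} fun i =>
        ∏ a, ENNReal.ofReal (x (i a))).symm
    refine tsum_congr fun f => ?_
    rw [Set.indicator_apply]
    refine ite_congr_of_iff ?_
    change _ ↔ Monotone f ∧ _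
    rw [monotone_iff_forall_adjacent]
    exact ⟨fun h => ⟨fun a b hab => (h a b hab).1, fun a b hab => (h a b hab).2⟩,
      fun h a b hab => ⟨h.1 a b hab, h.2 a b hab⟩⟩
  -- Summability is not needed: for a divergent sum both conventions give `0`.
  rw [h1, ENNReal.tsum_toReal_eq fun _ => ENNReal.prod_ne_top fun _ _ => ENNReal.ofReal_ne_top]
  refine tsum_congr fun i => ?_
  rw [ENNReal.toReal_prod]
  exact Finset.prod_congr rfl fun a _ => (ENNReal.toReal_ofReal (hx _)).symm

theorem ThomaPoint.evalQSym_L (ω : ThomaPoint) {κ : Type} [LinearOrder κ] (e : κ ≃ ℕ) {n : ℕ}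
    (c : Composition n) :
    ω.evalQSym e (QSym.L c) = ∑ j ∈ Finset.range (n + 1), ∑ i ∈ Finset.range (j + 1),
      ((c.slice 0 j).slice 0 i).evalL ω.α *
        ((c.slice 0 j).slice i j).conj.evalL (fun k => ω.β (e k)) *
        (ω.γ ^ (n - j) / ((n - j).factorial : ℝ)) := by
  simp only [ThomaPoint.evalQSym, QSym.L, QSym.Δ, QSym.ν, QSym.evalAlphabet, QSym.evalExp,
    LinearMap.comp_apply, Finsupp.linearCombination_single, one_smul, map_sum,
    LinearMap.rTensor_tmul, TensorProduct.map_tmul, LinearMap.mul'_apply, TensorProduct.sum_tmul]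
  rfl

/-- The labellings detach the `α` part first, while `(Δ ⊗ id) ∘ Δ` detaches the `γ` part first; here
`j` is the joint size of the `α` and `β` parts. -/
theorem sum_antidiagonal_antidiagonal_eq_sum_range {M : Type} [AddCommMonoid M] (n : ℕ)
    (f : ℕ → ℕ → ℕ → M) :
    ∑ p ∈ Finset.HasAntidiagonal.antidiagonal n, ∑ q ∈ Finset.HasAntidiagonal.antidiagonal p.2,
        f p.1 q.1 q.2 =
      ∑ j ∈ Finset.range (n + 1), ∑ i ∈ Finset.range (j + 1), f i (j - i) (n - j) := by
  rw [Finset.sum_sigma', Finset.sum_sigma']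
  refine Finset.sum_bij' (fun s _ => ⟨s.1.1 + s.2.1, s.1.1⟩)
    (fun t _ => ⟨(t.2, n - t.2), (t.1 - t.2, n - t.1)⟩) ?_ ?_ ?_ ?_ ?_
  · rintro ⟨⟨i, m⟩, ⟨k, l⟩⟩ h
    simp only [Finset.mem_sigma, Finset.HasAntidiagonal.mem_antidiagonal, Finset.mem_range] at h ⊢
    omega
  · rintro ⟨j, i⟩ h
    simp only [Finset.mem_sigma, Finset.HasAntidiagonal.mem_antidiagonal, Finset.mem_range] at h ⊢
    omega
  · rintro ⟨⟨i, m⟩, ⟨k, l⟩⟩ h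
    simp only [Finset.mem_sigma, Finset.HasAntidiagonal.mem_antidiagonal] at h
    obtain ⟨h1, h2⟩ := h
    subst h1
    subst h2
    simp
    omega
  · rintro ⟨j, i⟩ h
    simp only [Finset.mem_sigma, Finset.mem_range] at h
    simp
    omega
  · rintro ⟨⟨i, m⟩, ⟨k, l⟩⟩ h
    simp only [Finset.mem_sigma, Finset.HasAntidiagonal.mem_antidiagonal] at h
    obtain ⟨h1, h2⟩ := h
    subst h1
    subst h2
    simp only
    congr 1 <;> omega

/-! ### Comparison of the shuffle with the specialization -/

theorem ThomaPoint.γ_nonneg (ω : ThomaPoint) : 0 ≤ ω.γ := by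
  have := ω.sum_le_one
  unfold ThomaPoint.γ
  linarith

/-- The shuffle whose `β`-blocks lie in the order of `κ` has the law given by the alphabet `B̄`
listed in the opposite order. -/
theorem ThomaPoint.shuffleProb_eq_evalG (ω : ThomaPoint) {κ κ' : Type} [LinearOrder κ]
    [LinearOrder κ'] (e : κ ≃ ℕ) (φ : κ' ≃ κ) (hφ : ∀ a b, φ a ≤ φ b ↔ b ≤ a) {n : ℕ}
    (σ : Equiv.Perm (Fin n)) : ω.shuffleProb e σ = ω.evalG (φ.trans e) σ := by
  have hsum := ω.shuffle_apply_ofFn_eq_sum e σ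
  simp only [Finset.mul_sum] at hsum
  rw [sum_antidiagonal_antidiagonal_eq_sum_range n fun i k l =>
    fundamentalSum i (· ∈ permDescents σ⁻¹) (fun a => ENNReal.ofReal (ω.α a)) *
      (fundamentalSum k (fun d => i + d ∉ permDescents σ⁻¹)
          (fun k => ENNReal.ofReal (ω.β (e k))) *
        (ENNReal.ofReal ω.γ ^ l * (l.factorial : ℝ≥0∞)⁻¹))] at hsum
  -- The total is a probability, so every summand is finite and `ENNReal.toReal` distributes over
  -- the sums.
  have hfin : ω.shuffle e n (List.ofFn σ) ≠ ∞ := PMF.apply_ne_top _ _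
  rw [hsum] at hfin
  have hfin1 := fun j hj => ENNReal.sum_ne_top.1 hfin j hj
  have hG : FQSym.toQSym (FQSym.G σ) = QSym.L (permComposition σ⁻¹) := by
    simp [FQSym.toQSym, FQSym.G, FQSym.F, Finsupp.linearCombination_single]
  rw [ThomaPoint.shuffleProb, hsum, ThomaPoint.evalG, hG, ThomaPoint.evalQSym_L,
    ENNReal.toReal_sum hfin1]
  refine Finset.sum_congr rfl fun j hj => ?_
  rw [ENNReal.toReal_sum fun i hi => ENNReal.sum_ne_top.1 (hfin1 j hj) i hi]
  refine Finset.sum_congr rfl fun i hi => ?_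
  rw [Finset.mem_range] at hi hj
  have hperm : ∀ d, 0 < d → d < n →
      (d ∈ (permComposition σ⁻¹).descents ↔ d ∈ permDescents σ⁻¹) := fun d h0 hn => by
    rw [permComposition, Composition.mem_descents_ofDescents]
    simp [h0, hn]
  have hj0 : ∀ d, 0 < d → d < j → (d ∈ ((permComposition σ⁻¹).slice 0 j).descents ↔
      d ∈ permDescents σ⁻¹) := fun d h0 hd => by
    rw [Composition.mem_descents_slice _ h0 (by omega), zero_add, hperm d h0 (by omega)]
  rw [ENNReal.toReal_mul, ENNReal.toReal_mul, ENNReal.toReal_mul, ENNReal.toReal_pow,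
    ENNReal.toReal_ofReal ω.γ_nonneg, ENNReal.toReal_inv, ENNReal.toReal_natCast, ← div_eq_mul_inv,
    Composition.evalL_eq_toReal _ _ ω.α_nonneg,
    Composition.evalL_eq_toReal _ _ fun k => ω.β_nonneg _, mul_assoc]
  refine congrArg₂ (· * ·) (congrArg ENNReal.toReal ?_)
    (congrArg₂ (· * ·) (congrArg ENNReal.toReal ?_) rfl)
  · exact fundamentalSum_congr _ fun d h0 hd => by
      rw [Composition.mem_descents_slice _ h0 (by omega), zero_add, hj0 d h0 (by omega)]
  -- Undoing the reversal of the alphabet cancels the reversal of positions in `Composition.conj`,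
  -- leaving the plain complement of the descents.
  · refine Eq.trans ?_ (fundamentalSum_reverse φ hφ (j - i) _
      fun k => ENNReal.ofReal (ω.β (e k))).symm
    refine fundamentalSum_congr _ fun d h0 hd => ?_
    rw [Composition.mem_descents_conj _ (by omega) (by omega), Nat.sub_sub_self hd.le,
      Composition.mem_descents_slice _ h0 hd, hj0 _ (by omega) (by omega)]

theorem proposition2p2 (ω : ThomaPoint) (n : ℕ) (σ : Equiv.Perm (Fin n)) :
    ω.shuffleProb (OrderDual.ofDual : ℕᵒᵈ ≃ ℕ) σ = ω.Q σ ∧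
      ω.shuffleProb (Equiv.refl ℕ) σ = ω.evalG (OrderDual.ofDual : ℕᵒᵈ ≃ ℕ) σ := by
  constructor
  -- `OrderDual.toDual` followed by `OrderDual.ofDual` is the identity by definition, which gives
  -- `ω.Q`.
  · exact ω.shuffleProb_eq_evalG OrderDual.ofDual OrderDual.toDual
      (fun _ _ => OrderDual.toDual_le_toDual) σ
  · exact ω.shuffleProb_eq_evalG (Equiv.refl ℕ) OrderDual.ofDual
      (fun _ _ => OrderDual.ofDual_le_ofDual) σ
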